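/- Let $F$ and $G$ be probability distributions on $(0,\infty)$ (their distribution functions are denoted by the same letters), with no further restriction; in particular both may have atoms, also common ones. Let $T_1,T_2,\dots$ be i.i.d. with law $F$ and $C_1,C_2,\dots$ i.i.d. with law $G$, the sequence $(T_i)$ being independent of the sequence $(C_i)$. Put $X_i=\min(T_i,C_i)$, $\Delta_i=\mathbf 1_{\{T_i\le C_i\}}$, $S=1-F$, and let $H$ be the distribution function of $X_1$. Write $f(x-)$ for the left limit of $f$ at $x$, let $I_H=\{t>0: H(t-)<1\}$, and let $\int_0^\tau$ denote integration over $I_H$. For each $n$, order the sample $(X_1,\Delta_1),\dots,(X_n,\Delta_n)$ increasingly in the times as $(X_{[1:n]},\Delta_{[1:n]}),\dots,(X_{[n:n]},\Delta_{[n:n]})$, where at tied times the uncensored observations ($\Delta=1$) precede the censored ones and all other ties are ordered arbitrarily, and let $$W_i=\frac{\Delta_{[i:n]}}{n}\prod_{j=1}^{i-1}\left(1+\frac{1-\Delta_{[j:n]}}{n-j}\right),\qquad i=1,\dots,n,$$ be the Kaplan--Meier weights. Let $K:(0,\infty)^2\to\mathbb R$ be measurable, and let $$D_n=\sum_{i=1}^n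 K(X_{[i:n]},X_{[i:n]})\,W_i^2 .$$ (i) If $\int_0^\tau |K(x,x)|\sqrt{\frac{S(x-)}{1-G(x-)}}\,dF(x)<\infty$, then $\sqrt n\,D_n\to 0$ in probability as $n\to\infty$. (ii) If $\int_0^\tau \frac{|K(x,x)|}{1-G(x-)}\,dF(x)<\infty$, then $n\,D_n\to\int_0^\tau \frac{K(x,x)}{1-G(x-)}\,dF(x)$ in probability as $n\to\infty$. -/

import Mathlib

open MeasureTheory ProbabilityTheory Filter Topology

noncomputable section

/-- The observed times `Xᵢ = min(Tᵢ, Cᵢ)`. -/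
def obsTime {Ω : Type*} (T C : ℕ → Ω → ℝ) (i : ℕ) (ω : Ω) : ℝ := min (T i ω) (C i ω)

/-- The censoring indicators `Δᵢ = 1{Tᵢ ≤ Cᵢ}` (`1` means uncensored). -/
def censInd {Ω : Type*} (T C : ℕ → Ω → ℝ) (i : ℕ) (ω : Ω) : ℝ :=
  if T i ω ≤ C i ω then 1 else 0

/-- `1 - F(x-)`, with `F` the distribution function of the probability measure `μ`
and `F(x-)` its left limit. -/
def survLeft (μ : Measure ℝ) (x : ℝ) : ℝ := 1 - Function.leftLim (cdf μ) x

/-- `I_H = {t > 0 : H(t-) < 1}`, with `H` the distribution function of `μ`. It equals `(0, τ]` or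
`(0, τ)`, where `τ = sup {t : 1 - H(t) > 0}`, according to whether `H` jumps at `τ` or not. -/
def obsInterval (μ : Measure ℝ) : Set ℝ := {t | 0 < t ∧ Function.leftLim (cdf μ) t < 1}

/-- `σ` puts the sample `(xᵢ, δᵢ)` in increasing order of the times; where an uncensored and a
censored time are tied, the censored one comes later. All other ties are ordered arbitrarily. -/
def IsKMOrder {n : ℕ} (x δ : Fin n → ℝ) (σ : Equiv.Perm (Fin n)) : Prop :=
  ∀ i j : Fin n, i < j →
    x (σ i) < x (σ j) ∨ (x (σ i) = x (σ j) ∧ δ (σ j) ≤ δ (σ i))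

/-- Every sample has such an ordering. -/
theorem exists_isKMOrder {n : ℕ} (x δ : Fin n → ℝ) : ∃ σ, IsKMOrder x δ σ := by
  refine ⟨Tuple.sort (fun i => toLex (x i, -δ i)), fun i j hij => ?_⟩
  have h := Tuple.monotone_sort (fun i => toLex (x i, -δ i)) hij.le
  simpa [Prod.Lex.toLex_le_toLex] using h

/-- The Kaplan-Meier weight of the `i`-th ordered observation. The positions are numbered from `0`,
so that position `j` here is position `j + 1` in the usual formula
`Wᵢ = (Δ_[i:n] / n) ∏_{j < i} (1 + (1 - Δ_[j:n]) / (n - j))`. -/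
def kmWeight {n : ℕ} (δ : Fin n → ℝ) (σ : Equiv.Perm (Fin n)) (i : Fin n) : ℝ :=
  δ (σ i) / n * ∏ j ∈ Finset.Iio i, (1 + (1 - δ (σ j)) / ((n : ℝ) - ((j : ℕ) + 1)))

/-- The diagonal sum `∑ᵢ K(Xᵢ, Xᵢ) Wᵢ²`, each observation being paired with its own weight. -/
def kmDiag (K : ℝ → ℝ → ℝ) {n : ℕ} (x δ : Fin n → ℝ) (σ : Equiv.Perm (Fin n)) : ℝ :=
  ∑ i : Fin n, K (x (σ i)) (x (σ i)) * kmWeight δ σ i ^ 2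

end

/-! Write `g` and `s` for the `G`- and `F`-mass of `[x, ∞)`, that is `1 - G(x-)` and `S(x-)`. For an
uncensored observation at `x`, `n` times its Kaplan-Meier weight is a functional `W` of the other `m
= n - 1` pairs: the product of `1 + 1/y` over those censored before `x`, with `y` the risk set size
(`kmWeight_sort_eq`). So `D_n` is a sum of `Δ K W² / n²`, and everything rests on moments of `W` for
fixed `x`, valid for arbitrary `F` and `G` with atoms.

The core is a rearrangement inequality (`sum_perm_censProdCut_le`). Condition on the values of the
survival and of the censoring times, and average over all ways to pair them. Failures before `x` can
then only lower the mean of a product of factors `1 + κ/y`, so it is bounded by the case where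
subjects leave only by censoring. There the product telescopes to a function of the binomial number
`N` of censoring times `≥ x`. For `κ = k` this gives `E ∏ (1 + k/y) ≤ g⁻ᵏ`; for `κ = -1`, with a
cut-off at an empty risk set, it gives the mean of `N/m`, at most `g`.

Distinct censorings have distinct risk set sizes, so `(1 + 1/y)²` may be traded for `1 + 2/y`, and
`1/(1 + 1/y)` for `1 - 1/y`, at the price of a telescoping factor `1 + O(1/(Y+1))`, with `Y` the
number at risk at `x`. Hence `E W² ≤ 2/g²` for every sample size, `limsup E W² ≤ 1/g²`, and `limsup
E(1/W) ≤ g`. The last bound forces `liminf E W ≥ 1/g`, so `W → 1/g` in `L²`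
(`tendsto_integral_relWeight_sub_sq`).

For (ii), replacing `W²` by `1/g²` costs an `L¹` error that vanishes by dominated convergence, with
a multiple of `|K|/g` as majorant; the strong law handles what remains. For (i), uncensored
observations at points with `s g ≤ c/n` occur with probability at most `c`. Elsewhere `n^{-1/2} <
√(s g / c)`, which turns the bound `2|K| / (√n g)` on the mean contribution into the integrable
majorant `(2/√c) |K| √(s/g)`, so dominated convergence and Markov's inequality apply. -/

noncomputable section

/-! ### Censoring products and their average over all pairings of the times. -/

/-- The number of subjects at risk just before the `b`-th censoring time. Among tied censoring
times the order of the indices decides. -/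
def censRisk {m : ℕ} (t c : Fin m → ℝ) (b : Fin m) : ℕ :=
  (Finset.univ.filter fun l => c b < t l ∧ (c b < c l ∨ c b = c l ∧ b ≤ l)).card

/-- The product of `r y` over the subjects censored before `x`, with `y` the number of subjects
at risk at the censoring. -/
def censProd (r : ℕ → ℝ) {m : ℕ} (x : ℝ) (t c : Fin m → ℝ) : ℝ :=
  ∏ b, if c b < t b ∧ c b < x then r (censRisk t c b) else 1

/-- The number of subjects at risk at `x`. -/
def riskAt {m : ℕ} (x : ℝ) (t c : Fin m → ℝ) : ℕ :=
  (Finset.univ.filter fun l => x ≤ t l ∧ x ≤ c l).card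

/-- `censProd`, cut off to `0` where fewer than `d` subjects are at risk at `x`. -/
def censProdCut (r : ℕ → ℝ) (d : ℕ) {m : ℕ} (x : ℝ) (t c : Fin m → ℝ) : ℝ :=
  if d ≤ riskAt x t c then censProd r x t c else 0

/-- `Tuple.sort` is stable: tied censoring times keep their index order, so the tie-break by index
survives this relabelling. It need not survive an arbitrary permutation. -/
theorem censRisk_comp_sort {m : ℕ} (t c : Fin m → ℝ) (b : Fin m) :
    censRisk (t ∘ Tuple.sort c) (c ∘ Tuple.sort c) b = censRisk t c (Tuple.sort c b) := by
  have hs := (Tuple.eq_sort_iff (f := c) (σ := Tuple.sort c)).1 rfl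
  unfold censRisk
  refine Finset.card_bij (fun l _ => Tuple.sort c l) ?_ ?_ ?_
  · intro l hl
    simp only [Finset.mem_filter, Finset.mem_univ, true_and, Function.comp] at hl ⊢
    refine ⟨hl.1, hl.2.imp id fun h => ⟨h.1, ?_⟩⟩
    rcases h.2.eq_or_lt with h' | h'
    · rw [h']
    · exact (hs.2 _ _ h' h.1).le
  · intro l _ l' _ h
    exact (Tuple.sort c).injective h
  · intro l hl
    refine ⟨(Tuple.sort c).symm l, ?_, by simp⟩
    simp only [Finset.mem_filter, Finset.mem_univ, true_and, Function.comp,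
      Equiv.apply_symm_apply] at hl ⊢
    refine ⟨hl.1, hl.2.imp id fun h => ⟨h.1, ?_⟩⟩
    by_contra! h'
    have := hs.2 _ _ h' (by simpa using h.1.symm)
    simp only [Equiv.apply_symm_apply] at this
    exact absurd h.2 (not_le.2 this)

theorem censProd_comp_sort (r : ℕ → ℝ) {m : ℕ} (x : ℝ) (t c : Fin m → ℝ) :
    censProd r x (t ∘ Tuple.sort c) (c ∘ Tuple.sort c) = censProd r x t c := by
  unfold censProd
  simp_rw [censRisk_comp_sort]
  exact Equiv.prod_comp (Tuple.sort c)
    (fun b => if c b < t b ∧ c b < x then r (censRisk t c b) else 1)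

theorem riskAt_comp_perm {m : ℕ} (x : ℝ) (t c : Fin m → ℝ) (τ : Equiv.Perm (Fin m)) :
    riskAt x (t ∘ τ) (c ∘ τ) = riskAt x t c := by
  unfold riskAt
  refine Finset.card_bij (fun l _ => τ l) (by simp) (fun l _ l' _ h => τ.injective h) ?_
  intro l hl
  exact ⟨τ.symm l, by simpa using hl, by simp⟩

theorem censProdCut_comp_sort (r : ℕ → ℝ) (d : ℕ) {m : ℕ} (x : ℝ) (t c : Fin m → ℝ) :
    censProdCut r d x (t ∘ Tuple.sort c) (c ∘ Tuple.sort c) = censProdCut r d x t c := by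
  unfold censProdCut
  rw [censProd_comp_sort, riskAt_comp_perm]

theorem censRisk_zero_of_monotone {m : ℕ} {t c : Fin (m + 1) → ℝ} (hc : Monotone c) :
    censRisk t c 0 = (Finset.univ.filter fun l => c 0 < t l).card := by
  unfold censRisk
  congr 1
  ext l
  simp only [Finset.mem_filter, Finset.mem_univ, true_and, and_iff_left_iff_imp]
  exact fun _ => (hc (Fin.zero_le l)).lt_or_eq.imp id fun h => ⟨h, Fin.zero_le l⟩

theorem censRisk_succ_of_monotone {m : ℕ} {t c : Fin (m + 1) → ℝ} (hc : Monotone c)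
    (b : Fin m) :
    censRisk t c b.succ = censRisk (fun l => t l.succ) (fun l => c l.succ) b := by
  unfold censRisk
  symm
  refine Finset.card_bij (fun l _ => l.succ) ?_ ?_ ?_
  · intro l hl
    simpa using hl
  · intro l _ l' _ h
    exact Fin.succ_injective _ h
  · intro l hl
    simp only [Finset.mem_filter, Finset.mem_univ, true_and] at hl
    induction l using Fin.cases with
    | zero =>
      rcases hl.2 with h | h
      · exact absurd h (not_lt.2 (hc (Fin.zero_le _)))
      · exact absurd h.2 (by simp)
    | succ l => exact ⟨l, by simpa using hl, rfl⟩

theorem censProd_succ_of_monotone (r : ℕ → ℝ) {m : ℕ} {x : ℝ} {t c : Fin (m + 1) → ℝ}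
    (hc : Monotone c) :
    censProd r x t c =
      (if c 0 < t 0 ∧ c 0 < x then r (Finset.univ.filter fun l => c 0 < t l).card else 1) *
        censProd r x (fun l => t l.succ) (fun l => c l.succ) := by
  unfold censProd
  rw [Fin.prod_univ_succ, censRisk_zero_of_monotone hc]
  simp_rw [censRisk_succ_of_monotone hc]

theorem riskAt_succ {m : ℕ} {x : ℝ} {t c : Fin (m + 1) → ℝ} (hx : c 0 < x) :
    riskAt x t c = riskAt x (fun l => t l.succ) (fun l => c l.succ) := by
  unfold riskAt
  symm
  refine Finset.card_bij (fun l _ => l.succ) (fun l hl => by simpa using hl)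
    (fun l _ l' _ h => Fin.succ_injective _ h) ?_
  intro l hl
  simp only [Finset.mem_filter, Finset.mem_univ, true_and] at hl
  induction l using Fin.cases with
  | zero => exact absurd hl.2 (not_le.2 hx)
  | succ l => exact ⟨l, by simpa using hl, rfl⟩

theorem censProd_of_forall_le (r : ℕ → ℝ) {m : ℕ} {x : ℝ} {t c : Fin m → ℝ}
    (hx : ∀ b, x ≤ c b) : censProd r x t c = 1 :=
  Finset.prod_eq_one fun b _ => if_neg fun h => absurd h.2 (not_lt.2 (hx b))

/-- The number of potential censoring times that are at least `x`. -/
def tailCount {m : ℕ} (x : ℝ) (c : Fin m → ℝ) : ℕ := (Finset.univ.filter fun l => x ≤ c l).card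

theorem tailCount_comp_perm {m : ℕ} (x : ℝ) (c : Fin m → ℝ) (τ : Equiv.Perm (Fin m)) :
    tailCount x (c ∘ τ) = tailCount x c := by
  unfold tailCount
  refine Finset.card_bij (fun l _ => τ l) (by simp) (fun l _ l' _ h => τ.injective h) ?_
  intro l hl
  exact ⟨τ.symm l, by simpa using hl, by simp⟩

theorem tailCount_succ {m : ℕ} {x : ℝ} {c : Fin (m + 1) → ℝ} (hx : c 0 < x) :
    tailCount x c = tailCount x (fun l => c l.succ) := by
  unfold tailCount
  symm
  refine Finset.card_bij (fun l _ => l.succ) (fun l hl => by simpa using hl)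
    (fun l _ l' _ h => Fin.succ_injective _ h) ?_
  intro l hl
  simp only [Finset.mem_filter, Finset.mem_univ, true_and] at hl
  induction l using Fin.cases with
  | zero => exact absurd hl (not_le.2 hx)
  | succ l => exact ⟨l, by simpa using hl, rfl⟩

theorem tailCount_le {m : ℕ} (x : ℝ) (c : Fin m → ℝ) : tailCount x c ≤ m := by
  simpa [tailCount] using
    Finset.card_filter_le (Finset.univ : Finset (Fin m)) (fun l => x ≤ c l)

/-- Induction on the number of subjects by removing the smallest censoring time. Under a uniform
pairing its survival time exceeds it with probability `ρ/M`, where `ρ` survival times exceed it and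
`M` subjects are present. This yields the factor `r ρ`, otherwise `1`. The mean factor `(ρ r ρ + (M
- ρ))/M` is at most `r M` by `hr`, the value when all `M` subjects are still at risk. -/
theorem sum_perm_censProdCut_le_of_monotone (r : ℕ → ℝ) (d : ℕ) (hr0 : ∀ y, 0 ≤ r y)
    (hr : ∀ M y : ℕ, d ≤ y → y ≤ M → (y : ℝ) * r y + (M - y) ≤ M * r M) (x : ℝ) :
    ∀ (m : ℕ) (t c : Fin m → ℝ), Monotone c →
      ∑ π : Equiv.Perm (Fin m), censProdCut r d x (t ∘ π) c ≤
        m.factorial * if d ≤ tailCount x c then ∏ y ∈ Finset.Ioc (tailCount x c) m, r y else 0 := by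
  intro m
  induction m with
  | zero =>
    intro t c _
    simp [censProdCut, censProd, riskAt, tailCount]
  | succ m ih =>
    intro t c hc
    rcases le_or_gt x (c 0) with hx | hx
    · have hall : ∀ b, x ≤ c b := fun b => hx.trans (hc (Fin.zero_le b))
      have htc : tailCount x c = m + 1 := by
        unfold tailCount
        rw [Finset.filter_true_of_mem (fun b _ => hall b)]
        simp
      rw [htc]
      simp only [Finset.Ioc_self, Finset.prod_empty]
      calc ∑ π : Equiv.Perm (Fin (m + 1)), censProdCut r d x (t ∘ π) c
          ≤ ∑ π : Equiv.Perm (Fin (m + 1)), (if d ≤ m + 1 then (1 : ℝ) else 0) := by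
            refine Finset.sum_le_sum fun π _ => ?_
            unfold censProdCut
            rw [censProd_of_forall_le r hall]
            have : riskAt x (t ∘ π) c ≤ m + 1 := by
              simpa [riskAt] using Finset.card_filter_le (Finset.univ : Finset (Fin (m + 1)))
                (fun l => x ≤ (t ∘ π) l ∧ x ≤ c l)
            split_ifs with h1 h2 <;> first | rfl | (exfalso; omega) | norm_num
        _ = _ := by
            simp [Fintype.card_perm]
    · set B : ℝ := if d ≤ tailCount x (fun l => c l.succ) then
        ∏ y ∈ Finset.Ioc (tailCount x (fun l => c l.succ)) m, r y else 0 with hB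
      have hB0 : 0 ≤ B := by
        rw [hB]; split_ifs
        · exact Finset.prod_nonneg fun y _ => hr0 y
        · exact le_rfl
      set ρ : ℕ := (Finset.univ.filter fun l => c 0 < t l).card with hρ
      have hρm : ρ ≤ m + 1 := by
        simpa using Finset.card_filter_le (Finset.univ : Finset (Fin (m + 1))) (fun l => c 0 < t l)
      have hcs : Monotone fun l : Fin m => c l.succ :=
        hc.comp (Fin.strictMono_succ).monotone
      have hcard : ∀ π : Equiv.Perm (Fin (m + 1)),
          (Finset.univ.filter fun l => c 0 < (t ∘ π) l).card = ρ := by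
        intro π
        refine Finset.card_bij (fun l _ => π l) (by simp) (fun l _ l' _ h => π.injective h) ?_
        intro l hl
        exact ⟨π.symm l, by simpa using hl, by simp⟩
      have hstep : ∀ π : Equiv.Perm (Fin (m + 1)), censProdCut r d x (t ∘ π) c =
          (if c 0 < t (π 0) then r ρ else 1) *
            censProdCut r d x (fun l => t (π l.succ)) (fun l => c l.succ) := by
        intro π
        unfold censProdCut
        rw [riskAt_succ hx, censProd_succ_of_monotone r hc, hcard]
        simp only [Function.comp, hx, and_true, mul_ite, mul_zero]
      have hrhs : ((m + 1).factorial : ℝ) * (if d ≤ tailCount x c then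
          ∏ y ∈ Finset.Ioc (tailCount x c) (m + 1), r y else 0) =
          ((m + 1 : ℕ) * r (m + 1)) * (m.factorial * B) := by
        rw [tailCount_succ hx, hB, Nat.factorial_succ]
        split_ifs
        · rw [← Finset.insert_Ioc_right_eq_Ioc_add_one (tailCount_le x _),
            Finset.prod_insert (by simp)]
          push_cast; ring
        · simp
      rw [hrhs]
      by_cases hd : d ≤ ρ
      -- Split by the survival time `p` paired with the smallest censoring time. The bound `B` for
      -- the rest depends on the censoring times only, hence not on `p`.
      · rw [← Equiv.sum_comp (Equiv.Perm.decomposeFin).symm, Fintype.sum_prod_type]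
        simp_rw [hstep, Equiv.Perm.decomposeFin_symm_apply_zero,
          Equiv.Perm.decomposeFin_symm_apply_succ, ← Finset.mul_sum]
        have hih : ∀ p : Fin (m + 1), ∑ e : Equiv.Perm (Fin m),
            censProdCut r d x (fun l => t (Equiv.swap 0 p (e l).succ)) (fun l => c l.succ) ≤
              m.factorial * B := fun p =>
          ih (fun l => t (Equiv.swap 0 p l.succ)) _ hcs
        calc _ ≤ ∑ p : Fin (m + 1), (if c 0 < t p then r ρ else 1) * (m.factorial * B) := by
              refine Finset.sum_le_sum fun p _ => mul_le_mul_of_nonneg_left (hih p) ?_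
              split_ifs
              · exact hr0 _
              · exact zero_le_one
          _ = ((ρ : ℝ) * r ρ + ((m + 1 : ℕ) - ρ)) * (m.factorial * B) := by
              rw [← Finset.sum_mul, Finset.sum_ite, Finset.sum_const, Finset.sum_const,
                ← hρ, nsmul_eq_mul, nsmul_eq_mul, mul_one]
              congr 2
              have := Finset.card_filter_add_card_filter_not
                (s := (Finset.univ : Finset (Fin (m + 1)))) (fun l => c 0 < t l)
              rw [← hρ, Finset.card_univ, Fintype.card_fin] at this
              rw [eq_sub_iff_add_eq']
              exact_mod_cast this
          _ ≤ _ := mul_le_mul_of_nonneg_right (hr _ _ hd hρm) (by positivity)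
      -- Subjects at risk at `x` survive past `c 0`, so at most `ρ < d` of them exist and every term
      -- is cut off.
      · refine le_trans (le_of_eq ?_) (mul_nonneg (mul_nonneg (Nat.cast_nonneg _) (hr0 _))
          (by positivity))
        refine Finset.sum_eq_zero fun π _ => if_neg fun h => hd (h.trans ?_)
        rw [← hcard π]
        refine Finset.card_le_card fun l hl => ?_
        simp only [Finset.mem_filter, Finset.mem_univ, true_and] at hl ⊢
        exact hx.trans_le hl.1

/-- Averaged over all ways to assign the potential censoring times to the subjects, the product
is at most what it would be if no subject left the study before `x` except by censoring. -/
theorem sum_perm_censProdCut_le (r : ℕ → ℝ) (d : ℕ) (hr0 : ∀ y, 0 ≤ r y)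
    (hr : ∀ M y : ℕ, d ≤ y → y ≤ M → (y : ℝ) * r y + (M - y) ≤ M * r M) (x : ℝ)
    {m : ℕ} (t c : Fin m → ℝ) :
    ∑ π : Equiv.Perm (Fin m), censProdCut r d x (t ∘ π) c ≤
      m.factorial * if d ≤ tailCount x c then ∏ y ∈ Finset.Ioc (tailCount x c) m, r y else 0 := by
  have h := sum_perm_censProdCut_le_of_monotone r d hr0 hr x m t (c ∘ Tuple.sort c)
    (Tuple.monotone_sort c)
  rw [tailCount_comp_perm] at h
  refine le_trans (le_of_eq ?_) h
  refine Eq.trans (Finset.sum_congr rfl fun π _ => (censProdCut_comp_sort r d x (t ∘ π) c).symm) ?_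
  exact Equiv.sum_comp (Equiv.mulRight (Tuple.sort c))
    (fun π => censProdCut r d x (t ∘ π) (c ∘ Tuple.sort c))

end

/-! ### Pointwise comparison of censoring products with different factors. -/

noncomputable section

theorem riskAt_lt_censRisk {m : ℕ} {x : ℝ} {t c : Fin m → ℝ} {b : Fin m}
    (hb : c b < t b ∧ c b < x) : riskAt x t c < censRisk t c b := by
  refine Finset.card_lt_card (Finset.ssubset_iff_of_subset ?_ |>.2 ⟨b, ?_, ?_⟩)
  · intro l hl
    simp only [Finset.mem_filter, Finset.mem_univ, true_and] at hl ⊢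
    exact ⟨hb.2.trans_le hl.1, Or.inl (hb.2.trans_le hl.2)⟩
  · simp [hb.1]
  · simp [hb.2]

theorem censRisk_le {m : ℕ} (t c : Fin m → ℝ) (b : Fin m) : censRisk t c b ≤ m := by
  simpa [censRisk] using Finset.card_filter_le (Finset.univ : Finset (Fin m))
    (fun l => c b < t l ∧ (c b < c l ∨ c b = c l ∧ b ≤ l))

theorem riskAt_le {m : ℕ} (x : ℝ) (t c : Fin m → ℝ) : riskAt x t c ≤ m := by
  simpa [riskAt] using Finset.card_filter_le (Finset.univ : Finset (Fin m))
    (fun l => x ≤ t l ∧ x ≤ c l)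

theorem censRisk_lt_censRisk {m : ℕ} {t c : Fin m → ℝ} {b b' : Fin m} (hb : c b < t b)
    (h : c b < c b' ∨ c b = c b' ∧ b < b') : censRisk t c b' < censRisk t c b := by
  refine Finset.card_lt_card (Finset.ssubset_iff_of_subset ?_ |>.2 ⟨b, ?_, ?_⟩)
  · intro l hl
    simp only [Finset.mem_filter, Finset.mem_univ, true_and] at hl ⊢
    rcases h with h | h
    · refine ⟨h.trans hl.1, Or.inl ?_⟩
      rcases hl.2 with h' | h'
      · exact h.trans h'
      · exact h'.1 ▸ h
    · refine ⟨h.1 ▸ hl.1, ?_⟩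
      rcases hl.2 with h' | h'
      · exact Or.inl (h.1 ▸ h')
      · exact Or.inr ⟨h.1.trans h'.1, h.2.le.trans h'.2⟩
  · simp [hb]
  · simp only [Finset.mem_filter, Finset.mem_univ, true_and, not_and, not_or, not_lt, not_le]
    rcases h with h | h
    · exact fun _ => ⟨h.le, fun h' => absurd h' h.ne'⟩
    · exact fun _ => ⟨h.1.le, fun _ => h.2⟩

/-- A censored subject belongs to its own risk set but not to that of any later censoring, so the
sizes strictly decrease. Products over censored subjects are thereby products over distinct
integers, even with ties. -/
theorem censRisk_injOn {m : ℕ} (t c : Fin m → ℝ) :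
    Set.InjOn (censRisk t c) {b | c b < t b} := by
  intro b hb b' hb' h
  by_contra hne
  rcases lt_trichotomy (c b) (c b') with h1 | h1 | h1
  · exact absurd h (censRisk_lt_censRisk hb (Or.inl h1)).ne'
  · rcases lt_or_gt_of_ne hne with h2 | h2
    · exact absurd h (censRisk_lt_censRisk hb (Or.inr ⟨h1, h2⟩)).ne'
    · exact absurd h (censRisk_lt_censRisk hb' (Or.inr ⟨h1.symm, h2⟩)).ne
  · exact absurd h (censRisk_lt_censRisk hb' (Or.inl h1)).ne

theorem censProd_nonneg {r : ℕ → ℝ} (hr : ∀ y, 0 ≤ r y) {m : ℕ} (x : ℝ) (t c : Fin m → ℝ) :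
    0 ≤ censProd r x t c :=
  Finset.prod_nonneg fun b _ => by split_ifs; exacts [hr _, zero_le_one]

theorem censProd_congr {r r' : ℕ → ℝ} {m : ℕ} {x : ℝ} {t c : Fin m → ℝ}
    (h : ∀ y, riskAt x t c < y → r y = r' y) : censProd r x t c = censProd r' x t c := by
  refine Finset.prod_congr rfl fun b _ => ?_
  split_ifs with hb
  · exact h _ (riskAt_lt_censRisk hb)
  · rfl

theorem censProd_mul (r r' : ℕ → ℝ) {m : ℕ} (x : ℝ) (t c : Fin m → ℝ) :
    censProd (fun y => r y * r' y) x t c = censProd r x t c * censProd r' x t c := by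
  unfold censProd
  rw [← Finset.prod_mul_distrib]
  refine Finset.prod_congr rfl fun b _ => ?_
  split_ifs <;> simp

theorem censProd_inv (r : ℕ → ℝ) {m : ℕ} (x : ℝ) (t c : Fin m → ℝ) :
    censProd (fun y => (r y)⁻¹) x t c = (censProd r x t c)⁻¹ := by
  unfold censProd
  rw [← Finset.prod_inv_distrib]
  refine Finset.prod_congr rfl fun b _ => ?_
  split_ifs <;> simp

/-- The risk set sizes involved are distinct integers in `(Y, m]`, and adding the missing factors,
all at least `1`, only increases the product. What remains telescopes in the applications. -/
theorem censProd_le_prod_Ioc {r : ℕ → ℝ} {m : ℕ} {x : ℝ} {t c : Fin m → ℝ}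
    (hr : ∀ y, riskAt x t c < y → 1 ≤ r y) :
    censProd r x t c ≤ ∏ y ∈ Finset.Ioc (riskAt x t c) m, r y := by
  unfold censProd
  rw [← Finset.prod_filter, ← Finset.prod_image (f := r)
    (fun b hb b' hb' h => censRisk_injOn t c (by simp at hb; exact hb.1)
      (by simp at hb'; exact hb'.1) h)]
  have hsub : (Finset.univ.filter fun b => c b < t b ∧ c b < x).image (censRisk t c) ⊆
      Finset.Ioc (riskAt x t c) m := by
    intro y hy
    simp only [Finset.mem_image, Finset.mem_filter, Finset.mem_univ, true_and] at hy
    obtain ⟨b, hb, rfl⟩ := hy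
    exact Finset.mem_Ioc.2 ⟨riskAt_lt_censRisk hb, censRisk_le t c b⟩
  refine Finset.prod_le_prod_of_subset_of_one_le hsub (fun y hy => ?_) (fun y hy _ => ?_)
  · exact zero_le_one.trans (hr y (Finset.mem_Ioc.1 (hsub hy)).1)
  · exact hr y (Finset.mem_Ioc.1 hy).1

/-- The factor `1 + κ / y`. -/
def riskFactor (κ : ℝ) (y : ℕ) : ℝ := 1 + κ / y

theorem riskFactor_nonneg {κ : ℝ} (hκ : -1 ≤ κ) (y : ℕ) : 0 ≤ riskFactor κ y := by
  unfold riskFactor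
  rcases Nat.eq_zero_or_pos y with rfl | hy
  · simp
  · have hy' : (1 : ℝ) ≤ y := by exact_mod_cast hy
    have : -1 ≤ κ / y := by
      rw [le_div_iff₀ (by linarith)]; nlinarith
    linarith

theorem prod_Ioc_eq_div {f g : ℕ → ℝ} {Y m : ℕ} (hYm : Y ≤ m) (hg : ∀ y, Y ≤ y → g y ≠ 0)
    (h : ∀ y, Y ≤ y → f (y + 1) * g y = g (y + 1)) :
    ∏ y ∈ Finset.Ioc Y m, f y = g m / g Y := by
  induction m, hYm using Nat.le_induction with
  | base => simp [hg Y le_rfl]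
  | succ m hm ih =>
    rw [← Finset.insert_Ioc_right_eq_Ioc_add_one hm, Finset.prod_insert (by simp), ih, ← h m hm,
      mul_div_assoc]

/-- The ratio of `(1 + 1/y)²` to `1 + 2/y` is `(y+1)²/(y(y+2))`, whose product over `(Y, m]`
telescopes to at most `(Y+2)/(Y+1)`. -/
theorem censProd_one_sq_le {m : ℕ} (x : ℝ) (t c : Fin m → ℝ) :
    censProd (riskFactor 1) x t c ^ 2 ≤
      censProd (riskFactor 2) x t c * (1 + 1 / (riskAt x t c + 1)) := by
  set s : ℕ → ℝ := fun y => ((y : ℝ) + 1) ^ 2 / (y * (y + 2)) with hs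
  have h1 : censProd (riskFactor 1) x t c ^ 2 =
      censProd (riskFactor 2) x t c * censProd s x t c := by
    rw [sq, ← censProd_mul, ← censProd_mul]
    refine censProd_congr fun y hy => ?_
    have : (0 : ℝ) < y := by exact_mod_cast (Nat.zero_le _).trans_lt hy
    simp only [riskFactor, hs]
    field_simp
  rw [h1]
  refine mul_le_mul_of_nonneg_left ?_ (censProd_nonneg (riskFactor_nonneg (by norm_num)) _ _ _)
  refine (censProd_le_prod_Ioc fun y hy => ?_).trans ?_
  · have : (0 : ℝ) < y := by exact_mod_cast (Nat.zero_le _).trans_lt hy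
    simp only [hs]
    rw [le_div_iff₀ (by positivity)]
    nlinarith
  · rw [prod_Ioc_eq_div (g := fun y => ((y : ℝ) + 1) / (y + 2)) (riskAt_le x t c)
      (fun y _ => by positivity) (fun y _ => by simp only [hs]; push_cast; field_simp; ring)]
    have hY : (0 : ℝ) ≤ riskAt x t c := Nat.cast_nonneg _
    set Y : ℝ := (riskAt x t c : ℝ)
    have hm : (0 : ℝ) ≤ m := Nat.cast_nonneg _
    calc ((m : ℝ) + 1) / (m + 2) / ((Y + 1) / (Y + 2)) ≤ 1 / ((Y + 1) / (Y + 2)) := by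
          gcongr
          rw [div_le_one (by positivity)]; linarith
      _ = _ := by field_simp; ring

/-- Same telescoping for `(1 + 2/y)²` against `1 + 4/y`; the bound `(Y+3)(Y+4)/((Y+1)(Y+2))` is
largest at `Y = 0`, where it equals `6`. -/
theorem censProd_two_sq_le {m : ℕ} (x : ℝ) (t c : Fin m → ℝ) :
    censProd (riskFactor 2) x t c ^ 2 ≤ 6 * censProd (riskFactor 4) x t c := by
  set s : ℕ → ℝ := fun y => ((y : ℝ) + 2) ^ 2 / (y * (y + 4)) with hs
  have h1 : censProd (riskFactor 2) x t c ^ 2 =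
      censProd s x t c * censProd (riskFactor 4) x t c := by
    rw [sq, ← censProd_mul, ← censProd_mul]
    refine censProd_congr fun y hy => ?_
    have : (0 : ℝ) < y := by exact_mod_cast (Nat.zero_le _).trans_lt hy
    simp only [riskFactor, hs]
    field_simp
  rw [h1]
  refine mul_le_mul_of_nonneg_right ?_ (censProd_nonneg (riskFactor_nonneg (by norm_num)) _ _ _)
  refine (censProd_le_prod_Ioc fun y hy => ?_).trans ?_
  · have : (0 : ℝ) < y := by exact_mod_cast (Nat.zero_le _).trans_lt hy
    simp only [hs]
    rw [le_div_iff₀ (by positivity)]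
    nlinarith
  · rw [prod_Ioc_eq_div
      (g := fun y => ((y : ℝ) + 1) * (y + 2) / ((y + 3) * (y + 4))) (riskAt_le x t c)
      (fun y _ => by positivity) (fun y _ => by simp only [hs]; push_cast; field_simp; ring)]
    have hY : (0 : ℝ) ≤ riskAt x t c := Nat.cast_nonneg _
    set Y : ℝ := (riskAt x t c : ℝ)
    have hm : (0 : ℝ) ≤ m := Nat.cast_nonneg _
    rw [div_le_iff₀ (by positivity)]
    calc ((m : ℝ) + 1) * (m + 2) / ((m + 3) * (m + 4)) ≤ 1 := by
          rw [div_le_one (by positivity)]; nlinarith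
      _ ≤ _ := by
          rw [← mul_div_assoc, le_div_iff₀ (by positivity)]; nlinarith

theorem one_le_censProd {r : ℕ → ℝ} (hr : ∀ y, 1 ≤ r y) {m : ℕ} (x : ℝ) (t c : Fin m → ℝ) :
    1 ≤ censProd r x t c :=
  calc (1 : ℝ) = ∏ _b : Fin m, 1 := by simp
    _ ≤ _ := Finset.prod_le_prod (fun _ _ => zero_le_one)
      fun b _ => by split_ifs; exacts [hr _, le_rfl]

theorem one_le_riskFactor {κ : ℝ} (hκ : 0 ≤ κ) (y : ℕ) : 1 ≤ riskFactor κ y := by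
  unfold riskFactor
  have : 0 ≤ κ / y := by positivity
  linarith

/-- For `Y ≥ 1` the ratio of `1/(1 + 1/y)` to `1 - 1/y` is `y²/((y-1)(y+1))`, with product over `(Y,
m]` at most `1 + 1/Y ≤ 1 + 2/(Y+1)`; the product of the `1 - 1/y` is itself at most `1`. For `Y = 0`
the factor `1 - 1/y` may vanish, but the additive term then equals `2`. -/
theorem inv_censProd_le {m : ℕ} (x : ℝ) (t c : Fin m → ℝ) :
    (censProd (riskFactor 1) x t c)⁻¹ ≤
      censProdCut (riskFactor (-1)) 1 x t c + 2 * (1 / ((riskAt x t c : ℝ) + 1)) := by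
  unfold censProdCut
  split_ifs with hY
  · set s : ℕ → ℝ := fun y => (y : ℝ) ^ 2 / ((y - 1) * (y + 1)) with hs
    have h1 : (censProd (riskFactor 1) x t c)⁻¹ =
        censProd (riskFactor (-1)) x t c * censProd s x t c := by
      rw [← censProd_mul, ← censProd_inv]
      refine censProd_congr fun y hy => ?_
      have : (1 : ℝ) < y := by exact_mod_cast hY.trans_lt hy
      have h0 : (y : ℝ) - 1 ≠ 0 := by linarith
      have h2 : (y : ℝ) + 1 ≠ 0 := by linarith
      have h3 : (y : ℝ) ≠ 0 := by linarith
      simp only [riskFactor, hs]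
      rw [show 1 + 1 / (y : ℝ) = (y + 1) / y by field_simp,
        show 1 + -1 / (y : ℝ) = (y - 1) / y by field_simp; ring]
      field_simp
    have hle : censProd (riskFactor (-1)) x t c ≤ 1 := by
      refine Finset.prod_le_one (fun b _ => ?_) fun b _ => ?_
      · split_ifs; exacts [riskFactor_nonneg le_rfl _, zero_le_one]
      · split_ifs
        · have : (0 : ℝ) ≤ 1 / (censRisk t c b) := by positivity
          simp only [riskFactor, neg_div]; linarith
        · exact le_rfl
    have h0 := censProd_nonneg (riskFactor_nonneg (le_refl (-1))) x t c
    have h2 : censProd s x t c ≤ 1 + 2 * (1 / ((riskAt x t c : ℝ) + 1)) := by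
      refine (censProd_le_prod_Ioc fun y hy => ?_).trans ?_
      · have : (1 : ℝ) < y := by exact_mod_cast hY.trans_lt hy
        simp only [hs]
        rw [le_div_iff₀ (by nlinarith)]
        nlinarith
      · rw [prod_Ioc_eq_div (g := fun y => (y : ℝ) / (y + 1)) (riskAt_le x t c)
          (fun y hy => by
            have : 0 < y := hY.trans hy
            positivity)
          (fun y hy => by
            have : 0 < y := hY.trans hy
            simp only [hs]; push_cast
            rw [add_sub_cancel_right]
            field_simp)]
        have hY : (1 : ℝ) ≤ riskAt x t c := by exact_mod_cast hY
        set Y : ℝ := (riskAt x t c : ℝ)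
        have hm : (0 : ℝ) ≤ m := Nat.cast_nonneg _
        rw [div_le_iff₀ (by positivity)]
        calc (m : ℝ) / (m + 1) ≤ 1 := by
              rw [div_le_one (by positivity)]; linarith
          _ ≤ _ := by
              rw [show (1 + 2 * (1 / (Y + 1))) * (Y / (Y + 1)) = (Y + 3) * Y / ((Y + 1) ^ 2) by
                field_simp; ring, le_div_iff₀ (by positivity)]
              nlinarith
    rw [h1]
    have : 0 ≤ 2 * (1 / ((riskAt x t c : ℝ) + 1)) := by positivity
    nlinarith
  · have : riskAt x t c = 0 := by omega
    rw [this]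
    have := inv_le_one_of_one_le₀ (one_le_censProd (one_le_riskFactor zero_le_one) x t c)
    norm_num
    linarith

end

/-! ### Kaplan-Meier weights as censoring products over the other observations. -/

noncomputable section

theorem IsKMOrder.monotone_key {n : ℕ} {x δ : Fin n → ℝ} {σ : Equiv.Perm (Fin n)}
    (h : IsKMOrder x δ σ) : Monotone ((fun i => toLex (x i, -δ i)) ∘ σ) := by
  intro i j hij
  rcases hij.eq_or_lt with rfl | hij
  · exact le_rfl
  · simpa [Prod.Lex.toLex_le_toLex] using h i j hij

/-- All admissible orderings give the same diagonal sum. -/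
theorem kmDiag_eq_kmDiag (K : ℝ → ℝ → ℝ) {n : ℕ} {x δ : Fin n → ℝ} {σ τ : Equiv.Perm (Fin n)}
    (hσ : IsKMOrder x δ σ) (hτ : IsKMOrder x δ τ) : kmDiag K x δ σ = kmDiag K x δ τ := by
  have h := Tuple.unique_monotone hσ.monotone_key hτ.monotone_key
  have hx : ∀ i, x (σ i) = x (τ i) := fun i => by
    have := congrFun h i
    simp only [Function.comp, toLex_inj, Prod.mk.injEq] at this
    exact this.1
  have hδ : ∀ i, δ (σ i) = δ (τ i) := fun i => by
    have := congrFun h i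
    simp only [Function.comp, toLex_inj, Prod.mk.injEq, neg_inj] at this
    exact this.2
  unfold kmDiag kmWeight
  simp_rw [hx, hδ]

theorem card_filter_succAbove {m : ℕ} (a : Fin (m + 1)) (p : Fin (m + 1) → Prop)
    [DecidablePred p] :
    (Finset.univ.filter fun l : Fin m => p (a.succAbove l)).card =
      (Finset.univ.filter fun l => l ≠ a ∧ p l).card := by
  refine Finset.card_bij (fun l _ => a.succAbove l) ?_ ?_ ?_
  · intro l hl
    simpa using hl
  · intro l _ l' _ h
    exact Fin.succAbove_right_injective h
  · intro l hl
    simp only [Finset.mem_filter, Finset.mem_univ, true_and] at hl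
    obtain ⟨l', rfl⟩ := Fin.exists_succAbove_eq hl.1
    exact ⟨l', by simpa using hl.2, rfl⟩

/-- The denominator of the weight counts the positions after `j`, including `i`. Counting `j` itself
and leaving out `i` gives the same number, which lets the weight of `i` depend on the other
observations alone. -/
theorem card_filter_le_and_ne {m : ℕ} {i j : Fin (m + 1)} (hj : j < i) :
    (((Finset.univ.filter fun l : Fin (m + 1) => l ≠ i ∧ j ≤ l).card : ℕ) : ℝ) =
      ((m + 1 : ℕ) : ℝ) - ((j : ℕ) + 1) := by
  have : (Finset.univ.filter fun l : Fin (m + 1) => l ≠ i ∧ j ≤ l) = (Finset.Ici j).erase i := by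
    ext l; simp
  rw [this, Finset.card_erase_of_mem (by simpa using hj.le), Fin.card_Ici, Nat.cast_sub, Nat.cast_sub]
  · push_cast; ring
  · exact j.2.le
  · have := i.2
    have : (j : ℕ) < i := hj
    omega

/-- Up to the factor `n`, the Kaplan-Meier weight of an uncensored observation is a product over
the other observations. -/
theorem kmWeight_sort_eq {m : ℕ} (t c : Fin (m + 1) → ℝ) (i : Fin (m + 1))
    {σ : Equiv.Perm (Fin (m + 1))}
    (hσ : σ = Tuple.sort fun i => toLex (min (t i) (c i), -(if t i ≤ c i then (1 : ℝ) else 0)))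
    (hi : t (σ i) ≤ c (σ i)) :
    kmWeight (fun i => if t i ≤ c i then 1 else 0) σ i =
      censProd (riskFactor 1) (t (σ i)) (t ∘ (σ i).succAbove) (c ∘ (σ i).succAbove) /
        (m + 1 : ℕ) := by
  have hs := Tuple.eq_sort_iff.1 hσ
  have hlex : ∀ j l : Fin (m + 1), j ≤ l → min (t (σ j)) (c (σ j)) < min (t (σ l)) (c (σ l)) ∨
      (min (t (σ j)) (c (σ j)) = min (t (σ l)) (c (σ l)) ∧
        (t (σ l) ≤ c (σ l) → t (σ j) ≤ c (σ j))) := by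
    intro j l hjl
    have h := hs.1 hjl
    simp only [Function.comp, Prod.Lex.toLex_le_toLex, neg_le_neg_iff] at h
    refine h.imp id fun h => ⟨h.1, fun hl => ?_⟩
    by_contra hj
    have := h.2
    rw [if_pos hl, if_neg hj] at this
    linarith
  -- Stability of the sort: tied censored observations stand in index order, matching the tie-break
  -- of `censRisk`.
  have hties : ∀ j l : Fin (m + 1), j < l → c (σ j) = c (σ l) → c (σ j) < t (σ j) →
      c (σ l) < t (σ l) → σ j < σ l := by
    intro j l hjl h1 h2 h3
    refine hs.2 j l hjl ?_
    rw [min_eq_right h2.le, min_eq_right h3.le, if_neg h2.not_ge, if_neg h3.not_ge, h1]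
  set a := σ i with ha
  -- the risk set of a censored observation that precedes `a`
  have hrisk : ∀ j, j < i → c (σ j) < t (σ j) → ∀ b', a.succAbove b' = σ j →
      (censRisk (t ∘ a.succAbove) (c ∘ a.succAbove) b' : ℝ) =
        ((m + 1 : ℕ) : ℝ) - ((j : ℕ) + 1) := by
    intro j hj hcj b' hb'
    rw [← card_filter_le_and_ne hj]
    congr 1
    unfold censRisk
    simp only [Function.comp]
    have : ∀ l' : Fin m, (b' ≤ l' ↔ a.succAbove b' ≤ a.succAbove l') := fun l' => by simp
    simp_rw [this]
    rw [card_filter_succAbove a (fun l => c (a.succAbove b') < t l ∧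
      (c (a.succAbove b') < c l ∨ c (a.succAbove b') = c l ∧ a.succAbove b' ≤ l)), hb']
    symm
    refine Finset.card_bij (fun l _ => σ l) ?_ (fun l _ l' _ h => σ.injective h) ?_
    · intro l hl
      simp only [Finset.mem_filter, Finset.mem_univ, true_and] at hl ⊢
      refine ⟨fun h => hl.1 (σ.injective (h.trans ha)), ?_⟩
      rcases hlex j l hl.2 with h | h
      · rw [min_eq_right hcj.le, lt_min_iff] at h
        exact ⟨h.1, Or.inl h.2⟩
      · have hcl : c (σ l) < t (σ l) := by
          by_contra! h'
          exact absurd hcj (not_lt.2 (h.2 h'))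
        rw [min_eq_right hcj.le, min_eq_right hcl.le] at h
        refine ⟨h.1 ▸ hcl, Or.inr ⟨h.1, ?_⟩⟩
        rcases hl.2.eq_or_lt with h' | h'
        · rw [h']
        · exact (hties j l h' h.1 hcj hcl).le
    · intro l hl
      simp only [Finset.mem_filter, Finset.mem_univ, true_and] at hl
      refine ⟨σ.symm l, ?_, by simp⟩
      simp only [Finset.mem_filter, Finset.mem_univ, true_and]
      refine ⟨fun h => hl.1 (by rw [ha, ← h]; simp), ?_⟩
      by_contra! hlt
      have h := hlex _ _ hlt.le
      simp only [Equiv.apply_symm_apply, min_eq_right hcj.le] at h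
      rcases hl.2.2 with h' | h'
      · have hlt' : c (σ j) < min (t l) (c l) := lt_min hl.2.1 h'
        rcases h with h | h
        · exact absurd h (not_lt.2 hlt'.le)
        · exact absurd h.1 hlt'.ne'
      · have hcl : c l < t l := h'.1 ▸ hl.2.1
        have := hties _ _ hlt (by simpa using h'.1.symm) (by simpa using hcl) hcj
        simp only [Equiv.apply_symm_apply] at this
        exact absurd h'.2 (not_le.2 this)
  unfold kmWeight
  beta_reduce
  rw [← ha, if_pos hi, one_div, mul_comm, div_eq_mul_inv]
  congr 1
  set f : Fin (m + 1) → ℝ := fun j => if j < i then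
    1 + (1 - (if t (σ j) ≤ c (σ j) then (1 : ℝ) else 0)) / (((m + 1 : ℕ) : ℝ) - ((j : ℕ) + 1))
    else 1 with hf
  have h1 : ∏ j ∈ Finset.Iio i,
      (1 + (1 - (if t (σ j) ≤ c (σ j) then (1 : ℝ) else 0)) /
        (((m + 1 : ℕ) : ℝ) - ((j : ℕ) + 1))) = ∏ j, f j := by
    rw [hf, ← Finset.prod_filter]
    congr 1
    ext j; simp
  rw [h1, ← Equiv.prod_comp σ.symm f, Fin.prod_univ_succAbove _ a]
  have h2 : f (σ.symm a) = 1 := by simp [hf, ha]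
  rw [h2, one_mul]
  unfold censProd
  refine Finset.prod_congr rfl fun b' _ => ?_
  set j := σ.symm (a.succAbove b') with hj
  have hσj : σ j = a.succAbove b' := by simp [hj]
  have hne : j ≠ i := fun h => Fin.succAbove_ne a b' (by rw [← hσj, h])
  simp only [hf, Function.comp, ← hσj]
  by_cases hcj : c (σ j) < t (σ j)
  · rw [if_neg hcj.not_ge]
    -- A censoring tied with the uncensored time `t a` is placed after it, hence the strict
    -- inequality.
    have hiff : j < i ↔ c (σ j) < t a := by
      constructor
      · intro h
        rcases hlex j i h.le with h' | h'
        · rwa [min_eq_right hcj.le, ← ha, min_eq_left hi] at h'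
        · exact absurd (h'.2 hi) (not_le.2 hcj)
      · intro h
        by_contra! h'
        have := hlex i j h'
        rw [min_eq_right hcj.le, ← ha, min_eq_left hi] at this
        rcases this with h'' | h''
        · exact absurd h h''.not_gt
        · exact absurd h''.1 h.ne'
    by_cases hji : j < i
    · rw [if_pos hji, if_pos ⟨hcj, hiff.1 hji⟩]
      simp only [riskFactor, sub_zero]
      rw [← hrisk j hji hcj b' hσj.symm]
    · rw [if_neg hji, if_neg fun h => hji (hiff.2 h.2)]
  · simp [not_lt.1 hcj, hcj]

/-- Passes from ordered positions to subjects. The sum is the same for every admissible order, so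
the stable sort may be used. -/
theorem kmDiag_eq_sum (K : ℝ → ℝ → ℝ) {m : ℕ} (t c : Fin (m + 1) → ℝ)
    {σ : Equiv.Perm (Fin (m + 1))}
    (hσ : IsKMOrder (fun i => min (t i) (c i)) (fun i => if t i ≤ c i then 1 else 0) σ) :
    kmDiag K (fun i => min (t i) (c i)) (fun i => if t i ≤ c i then 1 else 0) σ =
      ∑ a, if t a ≤ c a then K (t a) (t a) *
        (censProd (riskFactor 1) (t a) (t ∘ a.succAbove) (c ∘ a.succAbove) / (m + 1 : ℕ)) ^ 2
        else 0 := by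
  set key : Fin (m + 1) → ℝ ×ₗ ℝ :=
    fun i => toLex (min (t i) (c i), -(if t i ≤ c i then (1 : ℝ) else 0)) with hkey
  have hτ : IsKMOrder (fun i => min (t i) (c i)) (fun i => if t i ≤ c i then 1 else 0)
      (Tuple.sort key) := by
    intro i j hij
    have h := Tuple.monotone_sort key hij.le
    simpa only [hkey, Function.comp, Prod.Lex.toLex_le_toLex, neg_le_neg_iff] using h
  rw [kmDiag_eq_kmDiag K hσ hτ, ← Equiv.sum_comp (Tuple.sort key)]
  unfold kmDiag
  refine Finset.sum_congr rfl fun i _ => ?_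
  by_cases hi : t (Tuple.sort key i) ≤ c (Tuple.sort key i)
  · rw [if_pos hi, kmWeight_sort_eq t c i rfl hi]
    simp only [min_eq_left hi]
    rfl
  · rw [if_neg hi]
    simp [kmWeight, hi]

end

/-! ### Moments of censoring products under independent sampling. -/

noncomputable section

/-- Decompose by the set of coordinates that fall in `A`: exactly one summand is nonzero at each
point, and each integral factors over the coordinates. -/
theorem integral_card_filter_mem {α : Type*} [MeasurableSpace α] (ν : Measure α)
    [IsProbabilityMeasure ν] {A : Set α} (hA : MeasurableSet A) [DecidablePred (· ∈ A)] {m : ℕ}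
    (f : ℕ → ℝ) :
    ∫ z, f (Finset.univ.filter fun l : Fin m => z l ∈ A).card ∂(Measure.pi fun _ => ν) =
      ∑ b ∈ Finset.range (m + 1),
        m.choose b • (f b * (ν.real A ^ b * (1 - ν.real A) ^ (m - b))) := by
  have hpt : ∀ z : Fin m → α, f (Finset.univ.filter fun l : Fin m => z l ∈ A).card =
      ∑ s ∈ (Finset.univ : Finset (Fin m)).powerset, f s.card *
        ∏ l, (if l ∈ s then A.indicator 1 (z l) else Aᶜ.indicator 1 (z l) : ℝ) := by
    intro z
    rw [Finset.sum_eq_single (Finset.univ.filter fun l : Fin m => z l ∈ A)]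
    · rw [Finset.prod_eq_one, mul_one]
      intro l _
      by_cases h : z l ∈ A <;> simp [h]
    · intro s _ hs
      have : ∃ l, ¬ (l ∈ s ↔ z l ∈ A) := by
        by_contra! h
        exact hs (by ext l; simp [h l])
      obtain ⟨l, hl⟩ := this
      rw [Finset.prod_eq_zero (Finset.mem_univ l), mul_zero]
      by_cases h : z l ∈ A <;> by_cases h' : l ∈ s <;> simp_all
    · simp
  have hind : ∀ (s : Finset (Fin m)) (l : Fin m), Integrable
      (fun a => (if l ∈ s then A.indicator 1 a else Aᶜ.indicator 1 a : ℝ)) ν := by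
    intro s l
    split_ifs
    · exact (integrable_const (1 : ℝ)).indicator hA
    · exact (integrable_const (1 : ℝ)).indicator hA.compl
  simp_rw [hpt]
  rw [integral_finsetSum _ fun s _ => (Integrable.fintype_prod (hind s)).const_mul _]
  have hint : ∀ s : Finset (Fin m), ∫ z, f s.card *
      ∏ l, (if l ∈ s then A.indicator 1 (z l) else Aᶜ.indicator 1 (z l) : ℝ)
        ∂(Measure.pi fun _ => ν) =
      f s.card * (ν.real A ^ s.card * (1 - ν.real A) ^ (m - s.card)) := by
    intro s
    rw [integral_const_mul, integral_fintype_prod_eq_prod (fun l a =>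
      (if l ∈ s then A.indicator 1 a else Aᶜ.indicator 1 a : ℝ))]
    congr 1
    have : ∀ l, ∫ a, (if l ∈ s then A.indicator 1 a else Aᶜ.indicator 1 a : ℝ) ∂ν =
        if l ∈ s then ν.real A else 1 - ν.real A := by
      intro l
      split_ifs
      · exact integral_indicator_one hA
      · rw [integral_indicator_one hA.compl, probReal_compl_eq_one_sub hA]
    simp_rw [this]
    rw [Finset.prod_ite]
    simp [Finset.filter_not, Finset.card_sdiff]
  simp_rw [hint]
  rw [Finset.sum_powerset_apply_card
    (fun b => f b * (ν.real A ^ b * (1 - ν.real A) ^ (m - b)))]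
  simp

/-- The inverse ascending moments of a binomial variable. -/
theorem pow_mul_integral_choose_div_choose_le {α : Type*} [MeasurableSpace α] (ν : Measure α)
    [IsProbabilityMeasure ν] {A : Set α} (hA : MeasurableSet A) [DecidablePred (· ∈ A)] (m k : ℕ) :
    ν.real A ^ k * ∫ z, (((m + k).choose m : ℝ) /
      (((Finset.univ.filter fun l : Fin m => z l ∈ A).card + k).choose
        (Finset.univ.filter fun l : Fin m => z l ∈ A).card)) ∂(Measure.pi fun _ => ν) ≤ 1 := by
  rw [integral_card_filter_mem ν hA (fun b => ((m + k).choose m : ℝ) / ((b + k).choose b)),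
    Finset.mul_sum]
  set p := ν.real A with hp
  have hp0 : 0 ≤ p := measureReal_nonneg
  have hp1 : 0 ≤ 1 - p := by
    have : p ≤ 1 := measureReal_le_one
    linarith
  calc _ = ∑ b ∈ Finset.range (m + 1),
        p ^ (b + k) * (1 - p) ^ (m + k - (b + k)) * (m + k).choose (b + k) := by
        refine Finset.sum_congr rfl fun b hb => ?_
        have hb : b ≤ m := Nat.lt_succ_iff.1 (Finset.mem_range.1 hb)
        -- This identity turns the weighted binomial term into the probability of `b + k` successes
        -- in `m + k` trials; the sum is then part of a total mass `1`.
        have h1 : (m + k).choose (b + k) * (b + k).choose b = (m + k).choose m * m.choose b := by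
          have := Nat.choose_mul (n := m + k) (k := b + k) (s := k) (by omega)
          rw [Nat.add_sub_cancel, Nat.add_sub_cancel] at this
          rw [Nat.choose_symm_add (a := b), this, Nat.choose_symm_add (a := m)]
        have h1' : ((m + k).choose (b + k) : ℝ) * (b + k).choose b =
            (m + k).choose m * m.choose b := by exact_mod_cast h1
        have h2 : ((b + k).choose b : ℝ) ≠ 0 := by
          exact_mod_cast (Nat.choose_pos (by omega)).ne'
        have h3 : ((m + k).choose (b + k) : ℝ) =
            (m + k).choose m * m.choose b / (b + k).choose b := by
          rw [eq_div_iff h2, h1']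
        rw [h3, nsmul_eq_mul, show m + k - (b + k) = m - b by omega]
        ring
    _ ≤ ∑ b ∈ Finset.range (m + k + 1), p ^ b * (1 - p) ^ (m + k - b) * (m + k).choose b := by
        rw [Finset.sum_image (f := fun b => p ^ b * (1 - p) ^ (m + k - b) * (m + k).choose b)
          (s := Finset.range (m + 1)) (g := fun b => b + k) (by intro a _ b _; simp) |>.symm]
        refine Finset.sum_le_sum_of_subset_of_nonneg ?_ fun b _ _ => by positivity
        intro b hb
        simp only [Finset.mem_image, Finset.mem_range] at hb ⊢
        omega
    _ = 1 := by rw [← add_pow]; simp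

theorem measurable_censRisk {m : ℕ} (b : Fin m) :
    Measurable fun p : ℝ × (Fin m → ℝ × ℝ) =>
      censRisk (fun i => (p.2 i).1) (fun i => (p.2 i).2) b := by
  unfold censRisk
  simp_rw [Finset.card_filter]
  refine Finset.measurable_sum _ fun l _ => Measurable.ite ?_ measurable_const measurable_const
  simp only [Set.ofPred_and, Set.ofPred_or]
  exact MeasurableSet.inter (measurableSet_lt (by fun_prop) (by fun_prop))
    (MeasurableSet.union (measurableSet_lt (by fun_prop) (by fun_prop))
      (MeasurableSet.inter (measurableSet_eq_fun (by fun_prop) (by fun_prop))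
        (MeasurableSet.const _)))

theorem measurable_riskAt {m : ℕ} :
    Measurable fun p : ℝ × (Fin m → ℝ × ℝ) =>
      riskAt p.1 (fun i => (p.2 i).1) (fun i => (p.2 i).2) := by
  unfold riskAt
  simp_rw [Finset.card_filter]
  refine Finset.measurable_sum _ fun l _ => Measurable.ite ?_ measurable_const measurable_const
  simp only [Set.ofPred_and]
  exact MeasurableSet.inter (measurableSet_le (by fun_prop) (by fun_prop))
    (measurableSet_le (by fun_prop) (by fun_prop))

theorem measurable_censProd (r : ℕ → ℝ) {m : ℕ} :
    Measurable fun p : ℝ × (Fin m → ℝ × ℝ) =>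
      censProd r p.1 (fun i => (p.2 i).1) (fun i => (p.2 i).2) := by
  unfold censProd
  refine Finset.measurable_prod _ fun b _ => Measurable.ite ?_
    (measurable_from_top.comp (measurable_censRisk b)) measurable_const
  simp only [Set.ofPred_and]
  exact MeasurableSet.inter (measurableSet_lt (by fun_prop) (by fun_prop))
    (measurableSet_lt (by fun_prop) (by fun_prop))

theorem measurable_censProdCut (r : ℕ → ℝ) (d : ℕ) {m : ℕ} :
    Measurable fun p : ℝ × (Fin m → ℝ × ℝ) =>
      censProdCut r d p.1 (fun i => (p.2 i).1) (fun i => (p.2 i).2) :=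
  Measurable.ite (measurable_riskAt (measurableSet_Ici (a := d))) (measurable_censProd r)
    measurable_const

theorem riskFactor_le {κ : ℝ} (hκ : -1 ≤ κ) (y : ℕ) : riskFactor κ y ≤ κ + 2 := by
  unfold riskFactor
  rcases Nat.eq_zero_or_pos y with rfl | hy
  · simp; linarith
  · have hy' : (1 : ℝ) ≤ y := by exact_mod_cast hy
    have : κ / y ≤ κ + 1 := by
      rw [div_le_iff₀ (by linarith)]; nlinarith
    linarith

theorem abs_censProd_riskFactor_le {κ : ℝ} (hκ : -1 ≤ κ) {m : ℕ} (x : ℝ) (t c : Fin m → ℝ) :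
    |censProd (riskFactor κ) x t c| ≤ (κ + 2) ^ m := by
  rw [abs_of_nonneg (censProd_nonneg (riskFactor_nonneg hκ) _ _ _)]
  calc censProd (riskFactor κ) x t c ≤ ∏ _b : Fin m, (κ + 2) := by
        refine Finset.prod_le_prod (fun b _ => ?_) fun b _ => ?_
        · split_ifs; exacts [riskFactor_nonneg hκ _, zero_le_one]
        · split_ifs; exacts [riskFactor_le hκ _, by linarith]
    _ = _ := by simp

theorem abs_censProdCut_riskFactor_le {κ : ℝ} (hκ : -1 ≤ κ) (d : ℕ) {m : ℕ} (x : ℝ)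
    (t c : Fin m → ℝ) : |censProdCut (riskFactor κ) d x t c| ≤ (κ + 2) ^ m := by
  unfold censProdCut
  split_ifs
  · exact abs_censProd_riskFactor_le hκ x t c
  · have : 0 ≤ κ + 2 := by linarith
    simpa using pow_nonneg this m

variable (F G : Measure ℝ) [IsProbabilityMeasure F] [IsProbabilityMeasure G]

/-- The law of `m` independent pairs of a survival time and a censoring time. -/
def pairLaw (m : ℕ) : Measure (Fin m → ℝ × ℝ) := Measure.pi fun _ => F.prod G

instance (m : ℕ) : IsProbabilityMeasure (pairLaw F G m) := by
  unfold pairLaw; infer_instance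

theorem measurePreserving_comp_perm {α : Type*} [MeasurableSpace α] (ν : Measure α)
    [IsProbabilityMeasure ν] {m : ℕ} (π : Equiv.Perm (Fin m)) :
    MeasurePreserving (fun z : Fin m → α => z ∘ π) (Measure.pi fun _ => ν)
      (Measure.pi fun _ => ν) := by
  refine ⟨by fun_prop, (Measure.pi_eq fun s hs => ?_).symm⟩
  rw [Measure.map_apply (by fun_prop) (MeasurableSet.univ_pi hs)]
  have : (fun z : Fin m → α => z ∘ π) ⁻¹' Set.univ.pi s = Set.univ.pi fun i => s (π.symm i) := by
    ext z
    simp only [Set.mem_preimage, Set.mem_univ_pi, Function.comp]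
    exact ⟨fun h i => by simpa using h (π.symm i), fun h i => by simpa using h (π i)⟩
  rw [this, Measure.pi_pi]
  exact Equiv.prod_comp π.symm fun i => ν (s i)

theorem measurePreserving_perm_fst {m : ℕ} (π : Equiv.Perm (Fin m)) :
    MeasurePreserving (fun (z : Fin m → ℝ × ℝ) i => ((z (π i)).1, (z i).2))
      (pairLaw F G m) (pairLaw F G m) := by
  have h1 := measurePreserving_arrowProdEquivProdArrow ℝ ℝ (Fin m) (fun _ => F) (fun _ => G)
  have h2 := (measurePreserving_comp_perm F π).prod
    (MeasurePreserving.id (Measure.pi fun _ : Fin m => G))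
  exact (h1.symm _).comp (h2.comp h1)

theorem integrable_censProdCut {κ : ℝ} (hκ : -1 ≤ κ) (d m : ℕ) (x : ℝ) :
    Integrable (fun z => censProdCut (riskFactor κ) d x (fun i => (z i).1) (fun i => (z i).2))
      (pairLaw F G m) :=
  Integrable.of_bound ((measurable_censProdCut _ d).comp
    (measurable_const.prodMk measurable_id)).aestronglyMeasurable ((κ + 2) ^ m)
    (ae_of_all _ fun _ => abs_censProdCut_riskFactor_le hκ d x _ _)

theorem integrable_censProd {κ : ℝ} (hκ : -1 ≤ κ) (m : ℕ) (x : ℝ) :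
    Integrable (fun z => censProd (riskFactor κ) x (fun i => (z i).1) (fun i => (z i).2))
      (pairLaw F G m) :=
  Integrable.of_bound ((measurable_censProd _).comp
    (measurable_const.prodMk measurable_id)).aestronglyMeasurable ((κ + 2) ^ m)
    (ae_of_all _ fun _ => abs_censProd_riskFactor_le hκ x _ _)

theorem measurable_tailCount {m : ℕ} (x : ℝ) :
    Measurable fun z : Fin m → ℝ × ℝ => tailCount x (fun i => (z i).2) := by
  unfold tailCount
  simp_rw [Finset.card_filter]
  exact Finset.measurable_sum _ fun l _ => Measurable.ite
    (measurableSet_le (by fun_prop) (by fun_prop)) measurable_const measurable_const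

theorem integrable_comp_tailCount (f : ℕ → ℝ) (m : ℕ) (x : ℝ) :
    Integrable (fun z => f (tailCount x (fun i => (z i).2))) (pairLaw F G m) := by
  refine Integrable.of_bound
    (measurable_from_top.comp (measurable_tailCount x)).aestronglyMeasurable
    (∑ b ∈ Finset.range (m + 1), |f b|) (ae_of_all _ fun z => ?_)
  exact Finset.single_le_sum (f := fun b => |f b|) (fun b _ => abs_nonneg _)
    (Finset.mem_range.2 (Nat.lt_succ_of_le (tailCount_le x _)))

/-- Survival times are i.i.d. and independent of the censoring times, so permuting them alone
preserves the law; the expectation equals its average over all permutations, to which the pairing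
inequality applies. -/
theorem integral_censProdCut_le {κ : ℝ} (hκ : -1 ≤ κ) (d m : ℕ) (x : ℝ)
    (hr : ∀ M y : ℕ, d ≤ y → y ≤ M →
      (y : ℝ) * riskFactor κ y + (M - y) ≤ M * riskFactor κ M) :
    ∫ z, censProdCut (riskFactor κ) d x (fun i => (z i).1) (fun i => (z i).2) ∂(pairLaw F G m) ≤
      ∫ z, (if d ≤ tailCount x (fun i => (z i).2) then
        ∏ y ∈ Finset.Ioc (tailCount x (fun i => (z i).2)) m, riskFactor κ y else 0)
        ∂(pairLaw F G m) := by
  have hperm : ∀ π : Equiv.Perm (Fin m),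
      ∫ z, censProdCut (riskFactor κ) d x ((fun i => (z i).1) ∘ π) (fun i => (z i).2)
        ∂(pairLaw F G m) =
      ∫ z, censProdCut (riskFactor κ) d x (fun i => (z i).1) (fun i => (z i).2)
        ∂(pairLaw F G m) := by
    intro π
    have h := measurePreserving_perm_fst F G π
    have := integral_map (μ := pairLaw F G m) h.measurable.aemeasurable
      (f := fun z => censProdCut (riskFactor κ) d x (fun i => (z i).1) (fun i => (z i).2))
      (by rw [h.map_eq]; exact (integrable_censProdCut F G hκ d m x).aestronglyMeasurable)
    rw [h.map_eq] at this
    exact this.symm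
  have hint : ∀ π : Equiv.Perm (Fin m), Integrable (fun z =>
      censProdCut (riskFactor κ) d x ((fun i => (z i).1) ∘ π) (fun i => (z i).2))
        (pairLaw F G m) := fun π =>
    (measurePreserving_perm_fst F G π).integrable_comp_of_integrable
      (integrable_censProdCut F G hκ d m x)
  have hfac : (0 : ℝ) < m.factorial := by exact_mod_cast m.factorial_pos
  refine le_of_mul_le_mul_left ?_ hfac
  calc _ = ∑ π : Equiv.Perm (Fin m),
        ∫ z, censProdCut (riskFactor κ) d x ((fun i => (z i).1) ∘ π) (fun i => (z i).2)
          ∂(pairLaw F G m) := by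
        simp_rw [hperm]
        simp [Fintype.card_perm]
    _ = ∫ z, ∑ π : Equiv.Perm (Fin m),
        censProdCut (riskFactor κ) d x ((fun i => (z i).1) ∘ π) (fun i => (z i).2)
          ∂(pairLaw F G m) := (integral_finsetSum _ fun π _ => hint π).symm
    _ ≤ ∫ z, (m.factorial : ℝ) * (if d ≤ tailCount x (fun i => (z i).2) then
          ∏ y ∈ Finset.Ioc (tailCount x (fun i => (z i).2)) m, riskFactor κ y else 0)
          ∂(pairLaw F G m) := integral_mono (integrable_finsetSum _ fun π _ => hint π)
        ((integrable_comp_tailCount F G (fun b => if d ≤ b then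
          ∏ y ∈ Finset.Ioc b m, riskFactor κ y else 0) m x).const_mul _)
        fun z => sum_perm_censProdCut_le _ d (riskFactor_nonneg hκ) hr x _ _
    _ = _ := integral_const_mul _ _

theorem prod_Ioc_riskFactor (k : ℕ) {N m : ℕ} (h : N ≤ m) :
    ∏ y ∈ Finset.Ioc N m, riskFactor k y = ((m + k).choose m : ℝ) / ((N + k).choose N) := by
  refine prod_Ioc_eq_div (g := fun y => ((y + k).choose y : ℝ)) h
    (fun y _ => by exact_mod_cast (Nat.choose_pos (by omega)).ne') fun y _ => ?_
  have := Nat.add_one_mul_choose_eq (y + k) y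
  have h' : ((y : ℝ) + k + 1) * (y + k).choose y = (y + 1 + k).choose (y + 1) * (y + 1) := by
    rw [show y + 1 + k = (y + k).succ by omega]
    exact_mod_cast this
  unfold riskFactor
  push_cast
  field_simp
  linarith

/-- The product over `(N, m]` telescopes to a ratio of binomial coefficients, with `N` binomial with
success probability `1 - G(x-)`; its mean is an inverse ascending moment. -/
theorem pow_mul_integral_censProd_le (k m : ℕ) (x : ℝ) :
    G.real (Set.Ici x) ^ k *
      ∫ z, censProd (riskFactor k) x (fun i => (z i).1) (fun i => (z i).2) ∂(pairLaw F G m) ≤ 1 := by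
  classical
  have h := integral_censProdCut_le F G (κ := k) (by linarith [k.cast_nonneg (α := ℝ)]) 0 m x (by
    intro M y _ hyM
    unfold riskFactor
    -- For `y > 0` both sides equal `M + k`. At `y = 0` division by zero makes the factor `1`, and
    -- nonnegativity of `k` suffices, so no cut-off is needed.
    rcases Nat.eq_zero_or_pos y with rfl | hy
    · have : (0 : ℝ) ≤ M * (k / M) := by positivity
      simp only [Nat.cast_zero, div_zero, zero_mul, sub_zero, mul_add, mul_one]
      linarith
    · have hy' : (y : ℝ) ≠ 0 := by exact_mod_cast hy.ne'
      have hM : (M : ℝ) ≠ 0 := by exact_mod_cast (hy.trans_le hyM).ne'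
      field_simp
      linarith)
  simp only [censProdCut, Nat.zero_le, if_true] at h
  simp_rw [prod_Ioc_riskFactor k (tailCount_le x _)] at h
  refine (mul_le_mul_of_nonneg_left h (by positivity)).trans ?_
  have h' := pow_mul_integral_choose_div_choose_le (F.prod G)
    (A := Set.univ ×ˢ Set.Ici x) (MeasurableSet.univ.prod measurableSet_Ici) m k
  have hA : (F.prod G).real (Set.univ ×ˢ Set.Ici x) = G.real (Set.Ici x) := by
    simp [measureReal_def]
  rw [hA] at h'
  refine le_trans (le_of_eq ?_) h'
  congr 1
  unfold pairLaw
  congr 1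
  ext z
  have : (Finset.univ.filter fun l : Fin m => z l ∈ Set.univ ×ˢ Set.Ici x).card =
      tailCount x (fun i => (z i).2) := by
    unfold tailCount; congr 1; ext l; simp
  rw [this]

theorem integral_tailCount (m : ℕ) (x : ℝ) :
    ∫ z, (tailCount x (fun i => (z i).2) : ℝ) ∂(pairLaw F G m) = m * G.real (Set.Ici x) := by
  have h1 : ∀ z : Fin m → ℝ × ℝ, (tailCount x (fun i => (z i).2) : ℝ) =
      ∑ l, (Set.univ ×ˢ Set.Ici x : Set (ℝ × ℝ)).indicator (fun _ => (1 : ℝ)) (z l) := by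
    intro z
    simp [tailCount, Set.indicator_apply]
  have hA : MeasurableSet (Set.univ ×ˢ Set.Ici x : Set (ℝ × ℝ)) :=
    MeasurableSet.univ.prod measurableSet_Ici
  have hint : Integrable ((Set.univ ×ˢ Set.Ici x : Set (ℝ × ℝ)).indicator (fun _ => (1 : ℝ)))
    (F.prod G) := (integrable_const (1 : ℝ)).indicator hA
  simp_rw [h1]
  have hev : ∀ l : Fin m, MeasurePreserving (Function.eval l) (pairLaw F G m) (F.prod G) :=
    fun l => measurePreserving_eval _ l
  rw [integral_finsetSum _ fun l _ => by
    exact (hev l).integrable_comp_of_integrable hint]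
  have : ∀ l : Fin m, ∫ z, (Set.univ ×ˢ Set.Ici x : Set (ℝ × ℝ)).indicator
      (fun _ => (1 : ℝ)) (z l) ∂(pairLaw F G m) = G.real (Set.Ici x) := by
    intro l
    have := integral_map (μ := pairLaw F G m) (hev l).measurable.aemeasurable
      (f := (Set.univ ×ˢ Set.Ici x : Set (ℝ × ℝ)).indicator (fun _ => (1 : ℝ)))
      (by rw [(hev l).map_eq]; exact hint.aestronglyMeasurable)
    rw [(hev l).map_eq] at this
    refine this.symm.trans ?_
    rw [integral_indicator hA]
    simp [measureReal_def]
  simp_rw [this]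
  simp

/-- The product of `1 - 1/y` over `(N, m]` is `N/m`, also for `N = 0` thanks to the cut-off. The
cut-off at `1` is forced, since the one-step inequality fails for `y = 0` and `κ = -1`. -/
theorem integral_censProdCut_neg_one_le (m : ℕ) (x : ℝ) :
    ∫ z, censProdCut (riskFactor (-1)) 1 x (fun i => (z i).1) (fun i => (z i).2)
      ∂(pairLaw F G m) ≤ G.real (Set.Ici x) := by
  refine (integral_censProdCut_le F G le_rfl 1 m x ?_).trans ?_
  · intro M y hy hyM
    have hy' : (y : ℝ) ≠ 0 := by exact_mod_cast (Nat.lt_of_lt_of_le zero_lt_one hy).ne'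
    have hM : (M : ℝ) ≠ 0 := by
      exact_mod_cast ((Nat.lt_of_lt_of_le zero_lt_one hy).trans_le hyM).ne'
    unfold riskFactor
    field_simp
    linarith
  · have hpt : ∀ z : Fin m → ℝ × ℝ, (if 1 ≤ tailCount x (fun i => (z i).2) then
        ∏ y ∈ Finset.Ioc (tailCount x (fun i => (z i).2)) m, riskFactor (-1) y else 0) =
        (tailCount x (fun i => (z i).2) : ℝ) / m := by
      intro z
      split_ifs with h
      · have hm := tailCount_le x (fun i => (z i).2)
        set N := tailCount x (fun i => (z i).2)
        rw [prod_Ioc_eq_div (g := fun y => ((y : ℝ))⁻¹) hm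
          (fun y hy => by
            have : 0 < y := Nat.lt_of_lt_of_le zero_lt_one (h.trans hy)
            positivity)
          (fun y hy => by
            have : 0 < y := Nat.lt_of_lt_of_le zero_lt_one (h.trans hy)
            unfold riskFactor
            push_cast
            field_simp
            ring)]
        simp [div_eq_mul_inv, mul_comm]
      · have : tailCount x (fun i => (z i).2) = 0 := by omega
        simp [this]
    simp_rw [hpt]
    rw [integral_div, integral_tailCount]
    rcases Nat.eq_zero_or_pos m with rfl | hm
    · simp
    · have : (m : ℝ) ≠ 0 := by exact_mod_cast hm.ne'
      rw [mul_div_cancel_left₀ _ this]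

/-- The number at risk is binomial with success probability `S(x-)(1 - G(x-))`; this is the case `k
= 1` of the inverse moment bound. -/
theorem mul_integral_inv_riskAt_le (m : ℕ) (x : ℝ) :
    F.real (Set.Ici x) * G.real (Set.Ici x) * ((m + 1 : ℝ) *
      ∫ z, 1 / ((riskAt x (fun i => (z i).1) (fun i => (z i).2) : ℝ) + 1) ∂(pairLaw F G m)) ≤ 1 := by
  classical
  have h := pow_mul_integral_choose_div_choose_le (F.prod G)
    (A := Set.Ici x ×ˢ Set.Ici x) (measurableSet_Ici.prod measurableSet_Ici) m 1
  have hA : (F.prod G).real (Set.Ici x ×ˢ Set.Ici x) =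
      F.real (Set.Ici x) * G.real (Set.Ici x) := measureReal_prod_prod _ _
  rw [hA, pow_one] at h
  refine le_trans (le_of_eq ?_) h
  congr 1
  rw [← integral_const_mul]
  unfold pairLaw
  congr 1
  ext z
  have : (Finset.univ.filter fun l : Fin m => z l ∈ Set.Ici x ×ˢ Set.Ici x).card =
      riskAt x (fun i => (z i).1) (fun i => (z i).2) := by
    rfl
  rw [this]
  simp [div_eq_mul_inv]

end

/-! ### Mean-square consistency of the relative weight at a fixed point. -/

noncomputable section

variable (F G : Measure ℝ) [IsProbabilityMeasure F] [IsProbabilityMeasure G]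

/-- The Kaplan-Meier weight, multiplied by the sample size, of an uncensored observation at `x`
when the other observations are given by the pairs `z`. -/
def relWeight {m : ℕ} (x : ℝ) (z : Fin m → ℝ × ℝ) : ℝ :=
  censProd (riskFactor 1) x (fun i => (z i).1) (fun i => (z i).2)

theorem measurable_relWeight {m : ℕ} :
    Measurable fun p : ℝ × (Fin m → ℝ × ℝ) => relWeight p.1 p.2 :=
  measurable_censProd _

theorem one_le_relWeight {m : ℕ} (x : ℝ) (z : Fin m → ℝ × ℝ) : 1 ≤ relWeight x z :=
  one_le_censProd (one_le_riskFactor zero_le_one) _ _ _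

theorem integrable_of_measurable_of_abs_le {m : ℕ} {f : (Fin m → ℝ × ℝ) → ℝ} (hf : Measurable f)
    {B : ℝ} (hB : ∀ z, |f z| ≤ B) : Integrable f (pairLaw F G m) :=
  Integrable.of_bound hf.aestronglyMeasurable B (ae_of_all _ hB)

theorem measurable_relWeight_right {m : ℕ} (x : ℝ) :
    Measurable fun z : Fin m → ℝ × ℝ => relWeight x z :=
  measurable_relWeight.comp (measurable_const.prodMk measurable_id)

theorem abs_relWeight_le {m : ℕ} (x : ℝ) (z : Fin m → ℝ × ℝ) : |relWeight x z| ≤ (1 + 2) ^ m :=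
  abs_censProd_riskFactor_le (by norm_num) _ _ _

theorem integrable_relWeight (m : ℕ) (x : ℝ) :
    Integrable (fun z => relWeight x z) (pairLaw F G m) :=
  integrable_of_measurable_of_abs_le F G (measurable_relWeight_right x) (abs_relWeight_le x)

theorem integrable_relWeight_sq (m : ℕ) (x : ℝ) :
    Integrable (fun z => relWeight x z ^ 2) (pairLaw F G m) := by
  refine integrable_of_measurable_of_abs_le F G ((measurable_relWeight_right x).pow_const 2)
    (B := ((1 + 2) ^ m) ^ 2) fun z => ?_
  rw [abs_pow]
  exact pow_le_pow_left₀ (abs_nonneg _) (abs_relWeight_le x z) 2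

theorem integrable_inv_relWeight (m : ℕ) (x : ℝ) :
    Integrable (fun z => (relWeight x z)⁻¹) (pairLaw F G m) := by
  refine integrable_of_measurable_of_abs_le F G (measurable_relWeight_right x).inv (B := 1)
    fun z => ?_
  have h := one_le_relWeight x z
  rw [abs_of_nonneg (inv_nonneg.2 (zero_le_one.trans h))]
  exact inv_le_one_of_one_le₀ h

theorem integrable_inv_riskAt (m : ℕ) (x : ℝ) :
    Integrable (fun z => 1 / ((riskAt x (fun i => (z i).1) (fun i => (z i).2) : ℝ) + 1))
      (pairLaw F G m) := by
  refine integrable_of_measurable_of_abs_le F G (B := 1) ?_ fun z => ?_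
  · exact (measurable_from_top (f := fun y : ℕ => 1 / ((y : ℝ) + 1))).comp
      (measurable_riskAt.comp (measurable_const.prodMk measurable_id))
  · rw [abs_of_nonneg (by positivity), div_le_one (by positivity)]
    linarith [(riskAt x (fun i => (z i).1) (fun i => (z i).2)).cast_nonneg (α := ℝ)]

variable {F G}

theorem integral_relWeight_sq_le {x : ℝ} (hg : 0 < G.real (Set.Ici x)) (m : ℕ) :
    ∫ z, relWeight x z ^ 2 ∂(pairLaw F G m) ≤ 2 / G.real (Set.Ici x) ^ 2 := by
  have h2 := pow_mul_integral_censProd_le F G 2 m x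
  rw [mul_comm, ← le_div_iff₀ (by positivity)] at h2
  calc _ ≤ ∫ z, 2 * censProd (riskFactor (2 : ℕ)) x (fun i => (z i).1) (fun i => (z i).2)
        ∂(pairLaw F G m) := by
        refine integral_mono (integrable_relWeight_sq F G m x)
          ((integrable_censProd F G (by norm_num) m x).const_mul _) fun z => ?_
        refine (censProd_one_sq_le x _ _).trans ?_
        have h0 := censProd_nonneg (riskFactor_nonneg (κ := 2) (by norm_num)) x
          (fun i => (z i).1) (fun i => (z i).2)
        rw [mul_comm]
        push_cast
        refine mul_le_mul_of_nonneg_right ?_ h0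
        have : 1 / ((riskAt x (fun i => (z i).1) (fun i => (z i).2) : ℝ) + 1) ≤ 1 := by
          rw [div_le_one (by positivity)]
          linarith [(riskAt x (fun i => (z i).1) (fun i => (z i).2)).cast_nonneg (α := ℝ)]
        linarith
    _ ≤ 2 * (1 / G.real (Set.Ici x) ^ 2) := by
        rw [integral_const_mul]; gcongr
    _ = _ := by ring

/-- The excess over `1/g²` comes from the product with factors `1 + 2/y` times `1/(Y+1)`. Young's
inequality with parameter `ε` separates the two; the square of the product is controlled by the
fourth-order product, the other part by the inverse moment of `Y + 1`. -/
theorem integral_relWeight_sq_le_add {x : ℝ} (hs : 0 < F.real (Set.Ici x))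
    (hg : 0 < G.real (Set.Ici x)) (m : ℕ) {ε : ℝ} (hε : 0 < ε) :
    ∫ z, relWeight x z ^ 2 ∂(pairLaw F G m) ≤ 1 / G.real (Set.Ici x) ^ 2 +
      (3 * ε * (1 / G.real (Set.Ici x) ^ 4) +
        1 / (2 * ε) * (1 / (F.real (Set.Ici x) * G.real (Set.Ici x) * (m + 1)))) := by
  have h2 := pow_mul_integral_censProd_le F G 2 m x
  have h4 := pow_mul_integral_censProd_le F G 4 m x
  have hr := mul_integral_inv_riskAt_le F G m x
  rw [mul_comm, ← le_div_iff₀ (by positivity)] at h2 h4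
  rw [← mul_assoc, mul_comm, ← le_div_iff₀ (by positivity)] at hr
  have i2 := integrable_censProd F G (κ := (2 : ℕ)) (by norm_num) m x
  have i4 := integrable_censProd F G (κ := (4 : ℕ)) (by norm_num) m x
  have ir := integrable_inv_riskAt F G m x
  calc _ ≤ ∫ z, (censProd (riskFactor (2 : ℕ)) x (fun i => (z i).1) (fun i => (z i).2) +
          (3 * ε * censProd (riskFactor (4 : ℕ)) x (fun i => (z i).1) (fun i => (z i).2) +
          1 / (2 * ε) * (1 / ((riskAt x (fun i => (z i).1) (fun i => (z i).2) : ℝ) + 1))))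
        ∂(pairLaw F G m) := by
        refine integral_mono (integrable_relWeight_sq F G m x)
          (i2.add ((i4.const_mul _).add (ir.const_mul _))) fun z => ?_
        refine (censProd_one_sq_le x _ _).trans ?_
        have h24 := censProd_two_sq_le x (fun i => (z i).1) (fun i => (z i).2)
        push_cast
        set a := censProd (riskFactor 2) x (fun i => (z i).1) (fun i => (z i).2)
        set b := censProd (riskFactor 4) x (fun i => (z i).1) (fun i => (z i).2)
        set w := 1 / ((riskAt x (fun i => (z i).1) (fun i => (z i).2) : ℝ) + 1) with hw
        have hw0 : 0 ≤ w := by positivity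
        have hw1 : w ≤ 1 := by
          rw [hw, div_le_one (by positivity)]
          linarith [(riskAt x (fun i => (z i).1) (fun i => (z i).2)).cast_nonneg (α := ℝ)]
        have key : a * w ≤ ε * a ^ 2 / 2 + w ^ 2 / (2 * ε) := by
          have : 0 ≤ (ε * a - w) ^ 2 / (2 * ε) := by positivity
          have e : (ε * a - w) ^ 2 / (2 * ε) = ε * a ^ 2 / 2 + w ^ 2 / (2 * ε) - a * w := by
            field_simp; ring
          linarith
        have k2 : ε * a ^ 2 / 2 ≤ 3 * ε * b := by nlinarith
        have k3 : w ^ 2 / (2 * ε) ≤ 1 / (2 * ε) * w := by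
          rw [div_mul_eq_mul_div, one_mul]
          gcongr
          nlinarith
        rw [mul_add, mul_one]
        linarith
    _ = ∫ z, censProd (riskFactor (2 : ℕ)) x (fun i => (z i).1) (fun i => (z i).2)
          ∂(pairLaw F G m) +
        (3 * ε * ∫ z, censProd (riskFactor (4 : ℕ)) x (fun i => (z i).1) (fun i => (z i).2)
          ∂(pairLaw F G m) + 1 / (2 * ε) *
          ∫ z, 1 / ((riskAt x (fun i => (z i).1) (fun i => (z i).2) : ℝ) + 1)
            ∂(pairLaw F G m)) := by
        rw [integral_add i2 (by exact (i4.const_mul _).add (ir.const_mul _)),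
          integral_add (i4.const_mul _) (ir.const_mul _), integral_const_mul, integral_const_mul]
    _ ≤ _ := by gcongr

/-- A direct lower bound on `E W` is not available from the pairing inequality, which bounds from
above. An upper bound on `E(1/W)` is, and convexity converts it. -/
theorem le_integral_relWeight {x : ℝ} (hs : 0 < F.real (Set.Ici x))
    (hg : 0 < G.real (Set.Ici x)) (m : ℕ) :
    1 / G.real (Set.Ici x) - 2 / G.real (Set.Ici x) ^ 2 *
      (1 / (F.real (Set.Ici x) * G.real (Set.Ici x) * (m + 1))) ≤
      ∫ z, relWeight x z ∂(pairLaw F G m) := by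
  have hr := mul_integral_inv_riskAt_le F G m x
  rw [← mul_assoc, mul_comm, ← le_div_iff₀ (by positivity)] at hr
  have hl := integral_censProdCut_neg_one_le F G m x
  have ir := integrable_inv_riskAt F G m x
  have ic := integrable_censProdCut F G (le_refl (-1)) 1 m x
  set g := G.real (Set.Ici x)
  have hinv : ∫ z, (relWeight x z)⁻¹ ∂(pairLaw F G m) ≤
      g + 2 * (1 / (F.real (Set.Ici x) * g * (m + 1))) := by
    calc _ ≤ ∫ z, (censProdCut (riskFactor (-1)) 1 x (fun i => (z i).1) (fun i => (z i).2) +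
          2 * (1 / ((riskAt x (fun i => (z i).1) (fun i => (z i).2) : ℝ) + 1)))
          ∂(pairLaw F G m) :=
          integral_mono (integrable_inv_relWeight F G m x) (ic.add (ir.const_mul _))
            fun z => inv_censProd_le x _ _
      _ ≤ _ := by
          rw [integral_add ic (ir.const_mul _), integral_const_mul]
          gcongr
  -- From `(w - 1/g)² / w ≥ 0`, that is `w ≥ 2/g - 1/(g² w)`.
  have hlow : ∫ z, (2 / g - 1 / g ^ 2 * (relWeight x z)⁻¹) ∂(pairLaw F G m) ≤
      ∫ z, relWeight x z ∂(pairLaw F G m) := by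
    refine integral_mono ((integrable_const _).sub
      ((integrable_inv_relWeight F G m x).const_mul _)) (integrable_relWeight F G m x) fun z => ?_
    have h1 := one_le_relWeight x z
    set w := relWeight x z
    have hw : 0 < w := by linarith
    have : 0 ≤ (w - 1 / g) ^ 2 / w := by positivity
    have e : (w - 1 / g) ^ 2 / w = w - (2 / g - 1 / g ^ 2 * w⁻¹) := by field_simp; ring
    simp only
    linarith
  rw [integral_sub (integrable_const _) ((integrable_inv_relWeight F G m x).const_mul _),
    integral_const_mul] at hlow
  simp only [integral_const, probReal_univ, smul_eq_mul, one_mul] at hlow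
  refine le_trans ?_ hlow
  have : 1 / g ^ 2 * ∫ z, (relWeight x z)⁻¹ ∂(pairLaw F G m) ≤
      1 / g ^ 2 * (g + 2 * (1 / (F.real (Set.Ici x) * g * (m + 1)))) := by gcongr
  have e : 1 / g ^ 2 * (g + 2 * (1 / (F.real (Set.Ici x) * g * (m + 1)))) =
      1 / g + 2 / g ^ 2 * (1 / (F.real (Set.Ici x) * g * (m + 1))) := by
    field_simp
  have e2 : 2 / g = 1 / g + 1 / g := by ring
  linarith

/-- The relative weight at `x` is a consistent estimator, in `L²`, of the inverse of the
probability of not being censored before `x`. -/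
theorem tendsto_integral_relWeight_sub_sq {x : ℝ} (hs : 0 < F.real (Set.Ici x))
    (hg : 0 < G.real (Set.Ici x)) :
    Tendsto (fun m => ∫ z, (relWeight x z - 1 / G.real (Set.Ici x)) ^ 2 ∂(pairLaw F G m))
      atTop (𝓝 0) := by
  set g := G.real (Set.Ici x) with hgdef
  set s := F.real (Set.Ici x) with hsdef
  have hlim : Tendsto (fun m : ℕ => √(1 / ((m : ℝ) + 1))) atTop (𝓝 0) := by
    have := (Real.continuous_sqrt.tendsto 0).comp (tendsto_one_div_add_atTop_nhds_zero_nat (𝕜 := ℝ))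
    rw [Real.sqrt_zero] at this
    exact this
  have hlim' : Tendsto (fun m : ℕ => (3 * (1 / g ^ 4) + 1 / (2 * (s * g))) * √(1 / ((m : ℝ) + 1)) +
      4 / (g ^ 3 * (s * g)) * (1 / ((m : ℝ) + 1))) atTop (𝓝 0) := by
    have := (hlim.const_mul (3 * (1 / g ^ 4) + 1 / (2 * (s * g)))).add
      ((tendsto_one_div_add_atTop_nhds_zero_nat (𝕜 := ℝ)).const_mul (4 / (g ^ 3 * (s * g))))
    rwa [mul_zero, mul_zero, add_zero] at this
  refine squeeze_zero (fun m => integral_nonneg fun z => sq_nonneg _) (fun m => ?_) hlim'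
  have hexp : ∫ z, (relWeight x z - 1 / g) ^ 2 ∂(pairLaw F G m) =
      ∫ z, relWeight x z ^ 2 ∂(pairLaw F G m) - 2 / g * ∫ z, relWeight x z ∂(pairLaw F G m) +
        1 / g ^ 2 := by
    have : ∀ z : Fin m → ℝ × ℝ, (relWeight x z - 1 / g) ^ 2 =
        relWeight x z ^ 2 - 2 / g * relWeight x z + 1 / g ^ 2 := fun z => by field_simp; ring
    simp_rw [this]
    have hi : Integrable (fun z : Fin m → ℝ × ℝ => relWeight x z ^ 2 - 2 / g * relWeight x z)
        (pairLaw F G m) :=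
      (integrable_relWeight_sq F G m x).sub ((integrable_relWeight F G m x).const_mul _)
    rw [integral_add hi (integrable_const _),
      integral_sub (integrable_relWeight_sq F G m x)
      ((integrable_relWeight F G m x).const_mul _), integral_const_mul]
    simp
  rw [hexp]
  have hm : (0 : ℝ) < (m : ℝ) + 1 := by positivity
  -- This choice balances the error terms of order `ε` and `1/(ε (m+1))`: both become of order `ε`.
  set ε := √(1 / ((m : ℝ) + 1)) with hεdef
  have hε : 0 < ε := Real.sqrt_pos.2 (by positivity)
  have hε2 : ε ^ 2 = 1 / ((m : ℝ) + 1) := Real.sq_sqrt (by positivity)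
  have h1 := integral_relWeight_sq_le_add hs hg m hε
  have h2 := le_integral_relWeight hs hg m
  rw [← hgdef, ← hsdef] at h1 h2
  have h3 : 2 / g * (1 / g - 2 / g ^ 2 * (1 / (s * g * (m + 1)))) ≤
      2 / g * ∫ z, relWeight x z ∂(pairLaw F G m) := by gcongr
  have e1 : 1 / (2 * ε) * (1 / (s * g * (m + 1))) = 1 / (2 * (s * g)) * ε := by
    have : (m : ℝ) + 1 = 1 / ε ^ 2 := by rw [hε2]; field_simp
    rw [this]; field_simp
  have e2 : 2 / g * (1 / g - 2 / g ^ 2 * (1 / (s * g * (m + 1)))) =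
      2 / g ^ 2 - 4 / (g ^ 3 * (s * g)) * (1 / (m + 1)) := by field_simp; ring
  have e3 : 2 / g ^ 2 = 1 / g ^ 2 + 1 / g ^ 2 := by ring
  rw [e1] at h1
  rw [e2] at h3
  linarith

/-- Use `w² - 1/g² = (w - 1/g)² + (2/g)(w - 1/g)`, with Young's inequality for the linear term at a
level `δ` held fixed while `m → ∞`. -/
theorem tendsto_integral_abs_relWeight_sq_sub {x : ℝ} (hs : 0 < F.real (Set.Ici x))
    (hg : 0 < G.real (Set.Ici x)) :
    Tendsto (fun m => ∫ z, |relWeight x z ^ 2 - 1 / G.real (Set.Ici x) ^ 2| ∂(pairLaw F G m))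
      atTop (𝓝 0) := by
  have hV := tendsto_integral_relWeight_sub_sq hs hg
  set g := G.real (Set.Ici x) with hgdef
  have hint : ∀ m, Integrable (fun z : Fin m → ℝ × ℝ => (relWeight x z - 1 / g) ^ 2)
      (pairLaw F G m) := by
    intro m
    have : ∀ z : Fin m → ℝ × ℝ, (relWeight x z - 1 / g) ^ 2 =
        relWeight x z ^ 2 - 2 / g * relWeight x z + 1 / g ^ 2 := fun z => by field_simp; ring
    simp_rw [this]
    exact ((integrable_relWeight_sq F G m x).sub
      ((integrable_relWeight F G m x).const_mul _)).add (integrable_const _)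
  have hbd : ∀ (δ : ℝ), 0 < δ → ∀ m, ∫ z, |relWeight x z ^ 2 - 1 / g ^ 2| ∂(pairLaw F G m) ≤
      δ / g + (1 + 1 / (g * δ)) * ∫ z, (relWeight x z - 1 / g) ^ 2 ∂(pairLaw F G m) := by
    intro δ hδ m
    calc _ ≤ ∫ z, (δ / g + (1 + 1 / (g * δ)) * (relWeight x z - 1 / g) ^ 2)
          ∂(pairLaw F G m) := by
          refine integral_mono ((integrable_relWeight_sq F G m x).sub (integrable_const _)).abs
            ((integrable_const _).add ((hint m).const_mul _)) fun z => ?_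
          set w := relWeight x z
          have e : w ^ 2 - 1 / g ^ 2 = (w - 1 / g) ^ 2 + 2 / g * (w - 1 / g) := by
            field_simp; ring
          have hu : 2 * |w - 1 / g| ≤ δ + (w - 1 / g) ^ 2 / δ := by
            have h0 : 0 ≤ (|w - 1 / g| - δ) ^ 2 / δ := by positivity
            have e' : (|w - 1 / g| - δ) ^ 2 / δ = δ + |w - 1 / g| ^ 2 / δ - 2 * |w - 1 / g| := by
              field_simp; ring
            rw [sq_abs] at e'
            linarith
          calc |w ^ 2 - 1 / g ^ 2| ≤ (w - 1 / g) ^ 2 + 1 / g * (2 * |w - 1 / g|) := by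
                rw [e]
                refine (abs_add_le _ _).trans (le_of_eq ?_)
                rw [abs_of_nonneg (sq_nonneg _), abs_mul, abs_of_pos (by positivity)]
                ring
            _ ≤ (w - 1 / g) ^ 2 + 1 / g * (δ + (w - 1 / g) ^ 2 / δ) := by gcongr
            _ = _ := by field_simp; ring
      _ = _ := by
          rw [integral_add (integrable_const _) ((hint m).const_mul _), integral_const_mul]
          simp
  rw [Metric.tendsto_atTop]
  intro ε hε
  set δ := ε * g / 2 with hδdef
  have hδ : 0 < δ := by positivity
  have hV' : Tendsto (fun m => δ / g + (1 + 1 / (g * δ)) *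
      ∫ z, (relWeight x z - 1 / g) ^ 2 ∂(pairLaw F G m)) atTop (𝓝 (δ / g)) := by
    simpa using (hV.const_mul (1 + 1 / (g * δ))).const_add (δ / g)
  have hlt : δ / g < ε := by
    rw [hδdef, div_lt_iff₀ hg]; nlinarith [mul_pos hε hg]
  obtain ⟨N, hN⟩ := eventually_atTop.1 (hV'.eventually_lt_const hlt)
  refine ⟨N, fun m hm => ?_⟩
  rw [Real.dist_eq, sub_zero, abs_of_nonneg (integral_nonneg fun z => abs_nonneg _)]
  exact (hbd δ hδ m).trans_lt (hN m hm)

end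

/-! ### Left limits as masses of half-lines, and the law of the sample. -/

noncomputable section

theorem survLeft_eq_measureReal_Ici (μ : Measure ℝ) [IsProbabilityMeasure μ] (x : ℝ) :
    survLeft μ x = μ.real (Set.Ici x) := by
  have h := StieltjesFunction.measure_Ici (cdf μ) (tendsto_cdf_atTop μ) x
  rw [measure_cdf] at h
  rw [measureReal_def, h, ENNReal.toReal_ofReal]
  · rfl
  · have := (monotone_cdf μ).leftLim_le (le_refl x)
    linarith [cdf_le_one μ x]

/-- The set is a half-line that may lack its endpoint. By inner regularity it is exhausted by
compact subsets, each contained in `[a, ∞)` for its least element `a`, whose mass is at most `u`.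
Atoms cause no difficulty. -/
theorem measure_setOf_measure_Ici_le (ν : Measure ℝ) [IsFiniteMeasure ν] (u : ENNReal) :
    ν {x | ν (Set.Ici x) ≤ u} ≤ u := by
  have hup : IsUpperSet {x | ν (Set.Ici x) ≤ u} := fun x y hxy hx =>
    (measure_mono (Set.Ici_subset_Ici.2 hxy)).trans hx
  rw [hup.ordConnected.measurableSet.measure_eq_iSup_isCompact]
  refine iSup₂_le fun A hA => iSup_le fun hAc => ?_
  rcases A.eq_empty_or_nonempty with rfl | hne
  · simp
  · obtain ⟨a, ha, hmin⟩ := hAc.exists_isLeast hne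
    exact (measure_mono fun y hy => hmin hy).trans (hA ha)

theorem measurable_measure_Ici (ν : Measure ℝ) : Measurable fun x => ν (Set.Ici x) :=
  Antitone.measurable fun _ _ h => measure_mono (Set.Ici_subset_Ici.2 h)

theorem measurable_measureReal_Ici (ν : Measure ℝ) : Measurable fun x => ν.real (Set.Ici x) :=
  (measurable_measure_Ici ν).ennreal_toReal

theorem tendstoInMeasure_of_sub {Ω : Type*} [MeasurableSpace Ω] {P : Measure Ω}
    {f f' : ℕ → Ω → ℝ} {g : Ω → ℝ}
    (h1 : TendstoInMeasure P (fun n ω => f n ω - f' n ω) atTop (fun _ => 0))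
    (h2 : TendstoInMeasure P f' atTop g) : TendstoInMeasure P f atTop g := by
  rw [tendstoInMeasure_iff_norm] at h1 h2 ⊢
  intro ε hε
  have h := (h1 (ε / 2) (by positivity)).add (h2 (ε / 2) (by positivity))
  rw [add_zero] at h
  refine tendsto_of_tendsto_of_tendsto_of_le_of_le tendsto_const_nhds h
    (fun _ => zero_le) fun n => ?_
  refine (measure_mono fun ω hω => ?_).trans (measure_union_le _ _)
  simp only [Set.mem_ofPred_eq, Set.mem_union, sub_zero] at hω ⊢
  by_contra! hcon
  have : ‖f n ω - g ω‖ ≤ ‖f n ω - f' n ω‖ + ‖f' n ω - g ω‖ := norm_sub_le_norm_sub_add_norm_sub ..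
  linarith [hcon.1, hcon.2]

theorem tendstoInMeasure_zero_of_tendsto_lintegral {Ω : Type*} [MeasurableSpace Ω]
    {P : Measure Ω} {f : ℕ → Ω → ℝ} (hf : ∀ n, Measurable (f n))
    (h : Tendsto (fun m => ∫⁻ ω, ‖f (m + 1) ω‖ₑ ∂P) atTop (𝓝 0)) :
    TendstoInMeasure P f atTop (fun _ => 0) := by
  refine tendstoInMeasure_of_tendsto_eLpNorm one_ne_zero
    (fun n => (hf n).aestronglyMeasurable) aestronglyMeasurable_const ?_
  rw [← tendsto_add_atTop_iff_nat 1]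
  refine h.congr fun m => ?_
  rw [eLpNorm_one_eq_lintegral_enorm]
  simp

section Sample

variable {Ω : Type*} [MeasurableSpace Ω] {P : Measure Ω} {F G : Measure ℝ} [IsProbabilityMeasure G]
    {T C : ℕ → Ω → ℝ}

theorem measure_map_obsTime_Ici (hTm : ∀ i, Measurable (T i)) (hCm : ∀ i, Measurable (C i))
    (hpair : ∀ i, P.map (fun ω => (T i ω, C i ω)) = F.prod G) (i : ℕ) (x : ℝ) :
    P.map (obsTime T C i) (Set.Ici x) = F (Set.Ici x) * G (Set.Ici x) := by
  have hm : Measurable (obsTime T C i) := (hTm i).min (hCm i)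
  rw [Measure.map_apply hm measurableSet_Ici, ← Measure.prod_prod, ← hpair i,
    Measure.map_apply ((hTm i).prodMk (hCm i)) (measurableSet_Ici.prod measurableSet_Ici)]
  congr 1
  ext ω
  simp [obsTime]

theorem mem_obsInterval_iff [IsProbabilityMeasure P] (hTm : ∀ i, Measurable (T i)) (hCm : ∀ i, Measurable (C i))
    (hpair : ∀ i, P.map (fun ω => (T i ω, C i ω)) = F.prod G) (x : ℝ) :
    x ∈ obsInterval (P.map (obsTime T C 0)) ↔
      0 < x ∧ 0 < F.real (Set.Ici x) ∧ 0 < G.real (Set.Ici x) := by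
  have hm : Measurable (obsTime T C 0) := (hTm 0).min (hCm 0)
  have := Measure.isProbabilityMeasure_map (μ := P) hm.aemeasurable
  have h : (P.map (obsTime T C 0)).real (Set.Ici x) = F.real (Set.Ici x) * G.real (Set.Ici x) := by
    rw [measureReal_def, measure_map_obsTime_Ici hTm hCm hpair, ENNReal.toReal_mul]; rfl
  have hs := survLeft_eq_measureReal_Ici (P.map (obsTime T C 0)) x
  rw [h] at hs
  unfold survLeft at hs
  simp only [obsInterval, Set.mem_ofPred_eq]
  refine and_congr_right fun _ => ?_
  have hF : 0 ≤ F.real (Set.Ici x) := measureReal_nonneg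
  have hG : 0 ≤ G.real (Set.Ici x) := measureReal_nonneg
  constructor
  · intro hlt
    have hpos : 0 < F.real (Set.Ici x) * G.real (Set.Ici x) := by linarith
    exact ⟨pos_of_mul_pos_left hpos hG, pos_of_mul_pos_right hpos hF⟩
  · intro hlt
    have := mul_pos hlt.1 hlt.2
    linarith

variable [IsProbabilityMeasure F]

theorem map_pairs_eq_pairLaw [IsProbabilityMeasure P] (hTm : ∀ i, Measurable (T i)) (hCm : ∀ i, Measurable (C i))
    (hTlaw : ∀ i, P.map (T i) = F) (hClaw : ∀ i, P.map (C i) = G)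
    (hTind : iIndepFun T P) (hCind : iIndepFun C P)
    (hTC : IndepFun (fun ω i => T i ω) (fun ω i => C i ω) P) (n : ℕ) :
    P.map (fun ω (i : Fin n) => (T i ω, C i ω)) = pairLaw F G n := by
  have hT : P.map (fun ω (i : Fin n) => T i ω) = Measure.pi fun _ => F := by
    have := (iIndepFun_iff_map_fun_eq_pi_map (fun i : Fin n => (hTm i).aemeasurable)).1
      (hTind.precomp Fin.val_injective)
    simpa only [hTlaw] using this
  have hC : P.map (fun ω (i : Fin n) => C i ω) = Measure.pi fun _ => G := by
    have := (iIndepFun_iff_map_fun_eq_pi_map (fun i : Fin n => (hCm i).aemeasurable)).1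
      (hCind.precomp Fin.val_injective)
    simpa only [hClaw] using this
  have hTC' : IndepFun (fun ω (i : Fin n) => T i ω) (fun ω (i : Fin n) => C i ω) P :=
    hTC.comp (φ := fun (t : ℕ → ℝ) (i : Fin n) => t i) (ψ := fun (t : ℕ → ℝ) (i : Fin n) => t i)
      (by fun_prop) (by fun_prop)
  have hprod := (indepFun_iff_map_prod_eq_prod_map_map
    (measurable_pi_lambda _ fun i : Fin n => hTm i).aemeasurable
    (measurable_pi_lambda _ fun i : Fin n => hCm i).aemeasurable).1 hTC'
  rw [hT, hC] at hprod
  have he := (measurePreserving_arrowProdEquivProdArrow ℝ ℝ (Fin n)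
    (fun _ => F) (fun _ => G)).symm
  rw [pairLaw, ← he.map_eq, ← hprod, Measure.map_map he.measurable]
  · rfl
  · exact (measurable_pi_lambda _ fun i : Fin n => hTm i).prodMk
      (measurable_pi_lambda _ fun i : Fin n => hCm i)

/-- Integration of a function of an uncensored observation and the remaining sample. -/
theorem lintegral_uncensored (hTm : ∀ i, Measurable (T i)) (hCm : ∀ i, Measurable (C i))
    (hlaw : ∀ n, P.map (fun ω (i : Fin n) => (T i ω, C i ω)) = pairLaw F G n)
    {m : ℕ} (a : Fin (m + 1)) {f : ℝ × (Fin m → ℝ × ℝ) → ENNReal} (hf : Measurable f) :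
    ∫⁻ ω, (if T a ω ≤ C a ω then f (T a ω, fun l => (T (a.succAbove l) ω, C (a.succAbove l) ω))
      else 0) ∂P = ∫⁻ x, G (Set.Ici x) * ∫⁻ z, f (x, z) ∂(pairLaw F G m) ∂F := by
  have hmeas : Measurable fun q : (ℝ × ℝ) × (Fin m → ℝ × ℝ) =>
      if q.1.1 ≤ q.1.2 then f (q.1.1, q.2) else 0 :=
    Measurable.ite (measurableSet_le (by fun_prop) (by fun_prop)) (by fun_prop) measurable_const
  have hp := measurePreserving_piFinSuccAbove (fun _ : Fin (m + 1) => F.prod G) a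
  have hZ : Measurable fun ω (i : Fin (m + 1)) => (T i ω, C i ω) :=
    measurable_pi_lambda _ fun i => (hTm i).prodMk (hCm i)
  have hmap : P.map (fun ω => ((T a ω, C a ω),
      fun l : Fin m => (T (a.succAbove l) ω, C (a.succAbove l) ω))) =
      (F.prod G).prod (pairLaw F G m) := by
    have h := hp.map_eq
    rw [show (Measure.pi fun _ : Fin (m + 1) => F.prod G) = pairLaw F G (m + 1) from rfl,
      ← hlaw (m + 1), Measure.map_map hp.measurable hZ] at h
    exact h
  have hZ' : Measurable fun ω => ((T a ω, C a ω),
      fun l : Fin m => (T (a.succAbove l) ω, C (a.succAbove l) ω)) :=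
    ((hTm a).prodMk (hCm a)).prodMk (measurable_pi_lambda _ fun i => (hTm _).prodMk (hCm _))
  have h1 := lintegral_map (μ := P) hmeas hZ'
  rw [hmap] at h1
  refine h1.symm.trans ?_
  rw [lintegral_prod _ hmeas.aemeasurable, lintegral_prod _ hmeas.lintegral_prod_right'.aemeasurable]
  refine lintegral_congr fun x => ?_
  have : ∀ c, ∫⁻ z, (if x ≤ c then f (x, z) else 0) ∂(pairLaw F G m) =
      (Set.Ici x).indicator (fun _ => ∫⁻ z, f (x, z) ∂(pairLaw F G m)) c := by
    intro c
    by_cases h : x ≤ c <;> simp [h]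
  simp only [this]
  rw [lintegral_indicator measurableSet_Ici, setLIntegral_const, mul_comm]

theorem map_pair_eq (hTm : ∀ i, Measurable (T i)) (hCm : ∀ i, Measurable (C i))
    (hlaw : ∀ n, P.map (fun ω (i : Fin n) => (T i ω, C i ω)) = pairLaw F G n) (i : ℕ) :
    P.map (fun ω => (T i ω, C i ω)) = F.prod G := by
  have h := (measurePreserving_eval (fun _ : Fin (i + 1) => F.prod G) (Fin.last i)).map_eq
  rw [show (Measure.pi fun _ : Fin (i + 1) => F.prod G) = pairLaw F G (i + 1) from rfl,
    ← hlaw (i + 1), Measure.map_map (by fun_prop)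
      (measurable_pi_lambda _ fun j => (hTm _).prodMk (hCm _))] at h
  simpa [Function.comp_def] using h

theorem indepFun_pair [IsProbabilityMeasure P] (hTm : ∀ i, Measurable (T i)) (hCm : ∀ i, Measurable (C i))
    (hlaw : ∀ n, P.map (fun ω (i : Fin n) => (T i ω, C i ω)) = pairLaw F G n) {i j : ℕ}
    (hij : i ≠ j) : IndepFun (fun ω => (T i ω, C i ω)) (fun ω => (T j ω, C j ω)) P := by
  have h : iIndepFun (fun (l : Fin (max i j + 1)) ω => (T l ω, C l ω)) P := by
    refine (iIndepFun_iff_map_fun_eq_pi_map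
      fun l : Fin (max i j + 1) => ((hTm l).prodMk (hCm l)).aemeasurable).2 ?_
    simp_rw [map_pair_eq hTm hCm hlaw]
    exact hlaw _
  exact h.indepFun (i := ⟨i, by omega⟩) (j := ⟨j, by omega⟩) (by simpa [Fin.ext_iff] using hij)

theorem measurableSet_obsInterval (μ : Measure ℝ) : MeasurableSet (obsInterval μ) := by
  have hm : Measurable (Function.leftLim (cdf μ)) := (monotone_cdf μ).leftLim.measurable
  exact (measurableSet_Ioi (a := (0 : ℝ))).inter (hm (measurableSet_Iio (a := (1 : ℝ))))

/-- Almost surely, uncensored times belong to the observation interval. -/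
theorem ae_mem_obsInterval_or [IsProbabilityMeasure P] (hF : F (Set.Iic 0) = 0)
    (hTm : ∀ i, Measurable (T i)) (hCm : ∀ i, Measurable (C i))
    (hpair : ∀ i, P.map (fun ω => (T i ω, C i ω)) = F.prod G) :
    ∀ᵐ x ∂F, x ∈ obsInterval (P.map (obsTime T C 0)) ∨
      (x ∉ obsInterval (P.map (obsTime T C 0)) ∧ G (Set.Ici x) = 0) := by
  have h1 : ∀ᵐ x ∂F, 0 < x := by
    rw [ae_iff]; convert hF using 2; ext x; simp
  have h2 : ∀ᵐ x ∂F, 0 < F.real (Set.Ici x) := by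
    rw [ae_iff]
    refine le_antisymm ((measure_mono fun x hx => ?_).trans
      (measure_setOf_measure_Ici_le F 0)) zero_le
    simp only [Set.mem_ofPred_eq, not_lt, measureReal_def] at hx ⊢
    have := le_antisymm hx ENNReal.toReal_nonneg
    rw [ENNReal.toReal_eq_zero_iff] at this
    exact (this.resolve_right (measure_ne_top _ _)).le
  filter_upwards [h1, h2] with x hx hFx
  rw [mem_obsInterval_iff hTm hCm hpair]
  by_cases hG : 0 < G.real (Set.Ici x)
  · exact Or.inl ⟨hx, hFx, hG⟩
  · refine Or.inr ⟨fun h => hG h.2.2, ?_⟩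
    have := le_antisymm (not_lt.1 hG) measureReal_nonneg
    rw [measureReal_def, ENNReal.toReal_eq_zero_iff] at this
    exact this.resolve_right (measure_ne_top _ _)

end Sample

end

/-! ### Part (ii): replacing the weights by their limits, and the law of large numbers. -/

noncomputable section

section Sample

variable {Ω : Type*} {F G : Measure ℝ} {T C : ℕ → Ω → ℝ}

/-- The limit of the relative weights, squared and weighted with `k`, for one observation. -/
def limitTerm (G : Measure ℝ) (k : ℝ → ℝ) (q : ℝ × ℝ) : ℝ :=
  if q.1 ≤ q.2 then k q.1 * (1 / G.real (Set.Ici q.1) ^ 2) else 0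

theorem measurable_limitTerm {k : ℝ → ℝ} (hk : Measurable k) : Measurable (limitTerm G k) := by
  refine Measurable.ite (measurableSet_le measurable_fst measurable_snd) ?_ measurable_const
  exact (hk.comp measurable_fst).mul
    (measurable_const.div (((measurable_measureReal_Ici G).comp measurable_fst).pow_const 2))

theorem measurable_weightError {k : ℝ → ℝ} (hk : Measurable k) {m : ℕ} :
    Measurable fun p : ℝ × (Fin m → ℝ × ℝ) => ENNReal.ofReal
      (|k p.1| * |relWeight p.1 p.2 ^ 2 - 1 / G.real (Set.Ici p.1) ^ 2|) := by
  have h1 : Measurable fun p : ℝ × (Fin m → ℝ × ℝ) => k p.1 := hk.comp measurable_fst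
  have h2 : Measurable fun p : ℝ × (Fin m → ℝ × ℝ) => G.real (Set.Ici p.1) :=
    (measurable_measureReal_Ici G).comp measurable_fst
  have h3 := measurable_relWeight (m := m)
  exact (h1.abs.mul ((h3.pow_const 2).sub
    (measurable_const.div (h2.pow_const 2))).abs).ennreal_ofReal

/-- The pairs of the subjects other than `a`. -/
def otherPairs (T C : ℕ → Ω → ℝ) {m : ℕ} (a : Fin (m + 1)) (ω : Ω) : Fin m → ℝ × ℝ :=
  fun l => (T (a.succAbove l) ω, C (a.succAbove l) ω)

theorem kmDiag_sample_eq (K : ℝ → ℝ → ℝ) {m : ℕ} {ω : Ω} {σ : Equiv.Perm (Fin (m + 1))}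
    (hσ : IsKMOrder (fun i : Fin (m + 1) => obsTime T C i ω)
      (fun i : Fin (m + 1) => censInd T C i ω) σ) :
    kmDiag K (fun i : Fin (m + 1) => obsTime T C i ω)
      (fun i : Fin (m + 1) => censInd T C i ω) σ =
      ∑ a : Fin (m + 1), if T a ω ≤ C a ω then
        K (T a ω) (T a ω) * (relWeight (T a ω) (otherPairs T C a ω) / (m + 1 : ℕ)) ^ 2 else 0 :=
  kmDiag_eq_sum K (fun i : Fin (m + 1) => T i ω) (fun i : Fin (m + 1) => C i ω) hσ

variable [MeasurableSpace Ω] {P : Measure Ω} [IsProbabilityMeasure F] [IsProbabilityMeasure G]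

theorem measurable_otherPairs (hTm : ∀ i, Measurable (T i)) (hCm : ∀ i, Measurable (C i))
    {m : ℕ} (a : Fin (m + 1)) : Measurable (otherPairs T C a) :=
  measurable_pi_lambda _ fun _ => (hTm _).prodMk (hCm _)

theorem measurable_kmDiag_sample (hTm : ∀ i, Measurable (T i)) (hCm : ∀ i, Measurable (C i))
    {K : ℝ → ℝ → ℝ} (hK : Measurable fun x => K x x) {n : ℕ} {σ : Ω → Equiv.Perm (Fin n)}
    (hσ : ∀ ω, IsKMOrder (fun i : Fin n => obsTime T C i ω)
      (fun i : Fin n => censInd T C i ω) (σ ω)) :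
    Measurable fun ω => kmDiag K (fun i : Fin n => obsTime T C i ω)
      (fun i : Fin n => censInd T C i ω) (σ ω) := by
  cases n with
  | zero => simp only [kmDiag, Finset.univ_eq_empty, Finset.sum_empty, measurable_const]
  | succ m =>
    simp_rw [fun ω => kmDiag_sample_eq K (hσ ω)]
    refine Finset.measurable_sum _ fun a _ => Measurable.ite
      (measurableSet_le (hTm _) (hCm _)) ?_ measurable_const
    exact (hK.comp (hTm _)).mul (((measurable_relWeight.comp
      ((hTm _).prodMk (measurable_otherPairs hTm hCm a))).div_const _).pow_const 2)

theorem ofReal_measureReal_Ici (x : ℝ) : ENNReal.ofReal (G.real (Set.Ici x)) = G (Set.Ici x) :=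
  ENNReal.ofReal_toReal (measure_ne_top _ _)

/-- Dominated convergence in `x`: the inner mean tends to `0` pointwise and is at most `3/g²`
uniformly in `m`, so that `g |k| · 3/g² = 3|k|/g` is an integrable majorant. Points outside the
observation interval have `g = 0`, up to an `F`-null set. -/
theorem tendsto_lintegral_mul_abs_relWeight_sq_sub [IsProbabilityMeasure P]
    (hF : F (Set.Iic 0) = 0)
    (hTm : ∀ i, Measurable (T i)) (hCm : ∀ i, Measurable (C i))
    (hpair : ∀ i, P.map (fun ω => (T i ω, C i ω)) = F.prod G)
    {k : ℝ → ℝ} (hk : Measurable k)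
    (hint : IntegrableOn (fun x => |k x| / survLeft G x) (obsInterval (P.map (obsTime T C 0))) F) :
    Tendsto (fun m => ∫⁻ x, G (Set.Ici x) * ∫⁻ z, ENNReal.ofReal
      (|k x| * |relWeight x z ^ 2 - 1 / G.real (Set.Ici x) ^ 2|) ∂(pairLaw F G m) ∂F)
      atTop (𝓝 0) := by
  set I := obsInterval (P.map (obsTime T C 0)) with hI
  have hterm : ∀ (m : ℕ) (x : ℝ), G (Set.Ici x) * ∫⁻ z, ENNReal.ofReal
      (|k x| * |relWeight x z ^ 2 - 1 / G.real (Set.Ici x) ^ 2|) ∂(pairLaw F G m) =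
      ENNReal.ofReal (G.real (Set.Ici x) * (|k x| *
        ∫ z, |relWeight x z ^ 2 - 1 / G.real (Set.Ici x) ^ 2| ∂(pairLaw F G m))) := by
    intro m x
    rw [← ofReal_measureReal_Ici, ENNReal.ofReal_mul measureReal_nonneg, ← integral_const_mul,
      ofReal_integral_eq_lintegral_ofReal _ (ae_of_all _ fun z => by positivity)]
    exact ((integrable_relWeight_sq F G m x).sub (integrable_const _)).abs.const_mul _
  have h0 : ∫⁻ _ : ℝ, (0 : ENNReal) ∂F = 0 := by simp
  rw [← h0]
  refine tendsto_lintegral_of_dominated_convergence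
    (fun x => I.indicator (fun x => ENNReal.ofReal (3 * (|k x| / survLeft G x))) x)
    (fun m => ?_) (fun m => ?_) ?_ ?_
  · exact (measurable_measure_Ici G).mul (measurable_weightError hk).lintegral_prod_right'
  · filter_upwards [ae_mem_obsInterval_or hF hTm hCm hpair] with x hx
    rcases hx with hx | hx
    · have hpos := (mem_obsInterval_iff hTm hCm hpair x).1 hx
      rw [Set.indicator_of_mem (hI ▸ hx), hterm, survLeft_eq_measureReal_Ici]
      refine ENNReal.ofReal_le_ofReal ?_
      have hg := hpos.2.2
      have hsq := integral_relWeight_sq_le (F := F) hg m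
      set g := G.real (Set.Ici x)
      have hle : ∫ z, |relWeight x z ^ 2 - 1 / g ^ 2| ∂(pairLaw F G m) ≤ 3 / g ^ 2 := by
        calc _ ≤ ∫ z, (relWeight x z ^ 2 + 1 / g ^ 2) ∂(pairLaw F G m) := by
              refine integral_mono ((integrable_relWeight_sq F G m x).sub
                (integrable_const _)).abs
                ((integrable_relWeight_sq F G m x).add (integrable_const _)) fun z => ?_
              refine (abs_sub _ _).trans (le_of_eq ?_)
              rw [abs_of_nonneg (sq_nonneg _), abs_of_nonneg (by positivity)]
          _ = ∫ z, relWeight x z ^ 2 ∂(pairLaw F G m) + 1 / g ^ 2 := by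
              rw [integral_add (integrable_relWeight_sq F G m x) (integrable_const _)]
              simp
          _ ≤ 2 / g ^ 2 + 1 / g ^ 2 := by gcongr
          _ = _ := by ring
      calc g * (|k x| * ∫ z, |relWeight x z ^ 2 - 1 / g ^ 2| ∂(pairLaw F G m))
          ≤ g * (|k x| * (3 / g ^ 2)) := by gcongr
        _ = _ := by field_simp
    · rw [hx.2, zero_mul]; exact zero_le
  · rw [lintegral_indicator (measurableSet_obsInterval _)]
    have := (hint.const_mul 3).lintegral_lt_top
    exact this.ne
  · filter_upwards [ae_mem_obsInterval_or hF hTm hCm hpair] with x hx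
    rcases hx with hx | hx
    · have hpos := (mem_obsInterval_iff hTm hCm hpair x).1 hx
      simp_rw [hterm]
      have := ((tendsto_integral_abs_relWeight_sq_sub hpos.2.1 hpos.2.2).const_mul
        (|k x|)).const_mul (G.real (Set.Ici x))
      rw [mul_zero, mul_zero] at this
      simpa using ENNReal.tendsto_ofReal this
    · simp [hx.2]

/-- Integrating out the censoring time multiplies `|k|/g²` by `g`, which leaves the assumed
integrand `|k|/g`. -/
theorem integrable_limitTerm [IsProbabilityMeasure P] (hF : F (Set.Iic 0) = 0)
    (hTm : ∀ i, Measurable (T i)) (hCm : ∀ i, Measurable (C i))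
    (hpair : ∀ i, P.map (fun ω => (T i ω, C i ω)) = F.prod G)
    {k : ℝ → ℝ} (hk : Measurable k)
    (hint : IntegrableOn (fun x => |k x| / survLeft G x) (obsInterval (P.map (obsTime T C 0))) F) :
    Integrable (limitTerm G k) (F.prod G) := by
  refine ⟨(measurable_limitTerm hk).aestronglyMeasurable, ?_⟩
  have hI := measurableSet_obsInterval (P.map (obsTime T C 0))
  unfold HasFiniteIntegral
  rw [lintegral_prod _ (measurable_limitTerm hk).enorm.aemeasurable]
  have hin : ∀ x, ∫⁻ c, ‖limitTerm G k (x, c)‖ₑ ∂G =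
      ENNReal.ofReal (|k x| * (1 / G.real (Set.Ici x) ^ 2)) * G (Set.Ici x) := by
    intro x
    have : ∀ c, ‖limitTerm G k (x, c)‖ₑ = (Set.Ici x).indicator
        (fun _ => ENNReal.ofReal (|k x| * (1 / G.real (Set.Ici x) ^ 2))) c := by
      intro c
      by_cases h : x ≤ c
      · simp only [limitTerm, h, if_true, Set.indicator_of_mem (Set.mem_Ici.2 h)]
        rw [Real.enorm_eq_ofReal_abs, abs_mul, abs_of_nonneg (a := 1 / _) (by positivity)]
      · simp [limitTerm, h]
    simp_rw [this]
    rw [lintegral_indicator measurableSet_Ici, setLIntegral_const]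
  simp_rw [hin]
  refine lt_of_le_of_lt (lintegral_mono_ae ?_)
    ((lintegral_indicator hI (fun x => ENNReal.ofReal (|k x| / survLeft G x))).le.trans_lt
      hint.lintegral_lt_top)
  filter_upwards [ae_mem_obsInterval_or hF hTm hCm hpair] with x hx
  rcases hx with hx | hx
  · have hpos := (mem_obsInterval_iff hTm hCm hpair x).1 hx
    rw [Set.indicator_of_mem hx, ← ofReal_measureReal_Ici, ← ENNReal.ofReal_mul (by positivity),
      survLeft_eq_measureReal_Ici]
    refine ENNReal.ofReal_le_ofReal (le_of_eq ?_)
    have := hpos.2.2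
    field_simp
  · simp [hx.2]

theorem integral_limitTerm [IsProbabilityMeasure P] (hF : F (Set.Iic 0) = 0)
    (hTm : ∀ i, Measurable (T i)) (hCm : ∀ i, Measurable (C i))
    (hpair : ∀ i, P.map (fun ω => (T i ω, C i ω)) = F.prod G)
    {k : ℝ → ℝ} (hk : Measurable k)
    (hint : IntegrableOn (fun x => |k x| / survLeft G x) (obsInterval (P.map (obsTime T C 0))) F) :
    ∫ q, limitTerm G k q ∂(F.prod G) =
      ∫ x in obsInterval (P.map (obsTime T C 0)), k x / survLeft G x ∂F := by
  rw [integral_prod _ (integrable_limitTerm hF hTm hCm hpair hk hint),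
    ← integral_indicator (measurableSet_obsInterval _)]
  refine integral_congr_ae ?_
  filter_upwards [ae_mem_obsInterval_or hF hTm hCm hpair] with x hx
  have hin : ∫ c, limitTerm G k (x, c) ∂G =
      G.real (Set.Ici x) * (k x * (1 / G.real (Set.Ici x) ^ 2)) := by
    have : ∀ c, limitTerm G k (x, c) = (Set.Ici x).indicator
        (fun _ => k x * (1 / G.real (Set.Ici x) ^ 2)) c := by
      intro c
      by_cases h : x ≤ c <;> simp [limitTerm, h]
    simp_rw [this]
    rw [integral_indicator measurableSet_Ici]
    simp
  rw [hin]
  rcases hx with hx | hx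
  · have hpos := (mem_obsInterval_iff hTm hCm hpair x).1 hx
    rw [Set.indicator_of_mem hx, survLeft_eq_measureReal_Ici]
    have := hpos.2.2
    field_simp
  · rw [Set.indicator_of_notMem hx.1, measureReal_def, hx.2]
    simp

theorem tendstoInMeasure_average_limitTerm [IsProbabilityMeasure P] (hF : F (Set.Iic 0) = 0)
    (hTm : ∀ i, Measurable (T i)) (hCm : ∀ i, Measurable (C i))
    (hlaw : ∀ n, P.map (fun ω (i : Fin n) => (T i ω, C i ω)) = pairLaw F G n)
    {k : ℝ → ℝ} (hk : Measurable k)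
    (hint : IntegrableOn (fun x => |k x| / survLeft G x) (obsInterval (P.map (obsTime T C 0))) F) :
    TendstoInMeasure P
      (fun (n : ℕ) ω => (∑ i ∈ Finset.range n, limitTerm G k (T i ω, C i ω)) / n) atTop
      (fun _ => ∫ x in obsInterval (P.map (obsTime T C 0)), k x / survLeft G x ∂F) := by
  have hpair := map_pair_eq hTm hCm hlaw
  have hlm := measurable_limitTerm (G := G) hk
  have hZ : ∀ i, Measurable fun ω => (T i ω, C i ω) := fun i => (hTm i).prodMk (hCm i)
  have hi := integrable_limitTerm hF hTm hCm hpair hk hint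
  refine tendstoInMeasure_of_tendsto_ae (fun n => ?_) ?_
  · exact ((Finset.measurable_sum _ fun i _ => hlm.comp (hZ i)).div_const _).aestronglyMeasurable
  have hsl := strong_law_ae_real (μ := P) (fun i ω => limitTerm G k (T i ω, C i ω))
    (by
      rw [← hpair 0, integrable_map_measure hlm.aestronglyMeasurable (hZ 0).aemeasurable] at hi
      exact hi)
    (fun i j hij => (indepFun_pair hTm hCm hlaw hij).comp hlm hlm)
    (fun i => (IdentDistrib.mk (hZ i).aemeasurable (hZ 0).aemeasurable
      ((hpair i).trans (hpair 0).symm)).comp hlm)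
  have hmean : ∫ ω, limitTerm G k (T 0 ω, C 0 ω) ∂P =
      ∫ x in obsInterval (P.map (obsTime T C 0)), k x / survLeft G x ∂F := by
    rw [← integral_limitTerm hF hTm hCm hpair hk hint]
    conv_rhs => rw [← hpair 0]
    exact (integral_map (hZ 0).aemeasurable hlm.aestronglyMeasurable).symm
  rw [hmean] at hsl
  exact hsl

/-- The difference between `n D_n` and the average of the limit terms has `L¹` norm at most the mean
error of a single observation, because all subjects contribute equally. -/
theorem tendstoInMeasure_mul_kmDiag [IsProbabilityMeasure P] (hF : F (Set.Iic 0) = 0)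
    (hTm : ∀ i, Measurable (T i)) (hCm : ∀ i, Measurable (C i))
    (hlaw : ∀ n, P.map (fun ω (i : Fin n) => (T i ω, C i ω)) = pairLaw F G n)
    {K : ℝ → ℝ → ℝ} (hk : Measurable fun x => K x x)
    {σ : (n : ℕ) → Ω → Equiv.Perm (Fin n)}
    (hσ : ∀ n ω, IsKMOrder (fun i : Fin n => obsTime T C i ω)
      (fun i : Fin n => censInd T C i ω) (σ n ω))
    (hint : IntegrableOn (fun x => |K x x| / survLeft G x)
      (obsInterval (P.map (obsTime T C 0))) F) :
    TendstoInMeasure P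
      (fun (n : ℕ) ω => (n : ℝ) * kmDiag K (fun i : Fin n => obsTime T C i ω)
        (fun i : Fin n => censInd T C i ω) (σ n ω)) atTop
      (fun _ => ∫ x in obsInterval (P.map (obsTime T C 0)), K x x / survLeft G x ∂F) := by
  have hpair := map_pair_eq hTm hCm hlaw
  have hlm := measurable_limitTerm (G := G) hk
  have hZ : ∀ i, Measurable fun ω => (T i ω, C i ω) := fun i => (hTm i).prodMk (hCm i)
  refine tendstoInMeasure_of_sub ?_ (tendstoInMeasure_average_limitTerm hF hTm hCm hlaw hk hint)
  refine tendstoInMeasure_zero_of_tendsto_lintegral (fun n => ?_) ?_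
  · exact ((measurable_kmDiag_sample hTm hCm hk (hσ n)).const_mul _).sub
      ((Finset.measurable_sum _ fun i _ => hlm.comp (hZ i)).div_const _)
  refine tendsto_of_tendsto_of_tendsto_of_le_of_le tendsto_const_nhds
    (tendsto_lintegral_mul_abs_relWeight_sq_sub hF hTm hCm hpair hk hint)
    (fun _ => zero_le) fun m => ?_
  set e : ℝ × (Fin m → ℝ × ℝ) → ENNReal := fun p => ENNReal.ofReal
    (|K p.1 p.1| * |relWeight p.1 p.2 ^ 2 - 1 / G.real (Set.Ici p.1) ^ 2|) with he
  have hem : Measurable e := measurable_weightError hk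
  have hnpos : (0 : ℝ) < (m + 1 : ℕ) := by positivity
  have hpt : ∀ ω, ‖((m + 1 : ℕ) : ℝ) * kmDiag K (fun i : Fin (m + 1) => obsTime T C i ω)
      (fun i : Fin (m + 1) => censInd T C i ω) (σ (m + 1) ω) -
      (∑ i ∈ Finset.range (m + 1), limitTerm G (fun x => K x x) (T i ω, C i ω)) /
        (m + 1 : ℕ)‖ₑ ≤ ((m + 1 : ℕ) : ENNReal)⁻¹ * ∑ a : Fin (m + 1),
        if T a ω ≤ C a ω then e (T a ω, otherPairs T C a ω) else 0 := by
    intro ω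
    rw [kmDiag_sample_eq K (hσ (m + 1) ω), Finset.sum_range]
    have hsum : ((m + 1 : ℕ) : ℝ) * (∑ a : Fin (m + 1), if T a ω ≤ C a ω then
        K (T a ω) (T a ω) * (relWeight (T a ω) (otherPairs T C a ω) / (m + 1 : ℕ)) ^ 2 else 0) -
        (∑ a : Fin (m + 1), limitTerm G (fun x => K x x) (T a ω, C a ω)) / (m + 1 : ℕ) =
        ((m + 1 : ℕ) : ℝ)⁻¹ * ∑ a : Fin (m + 1), if T a ω ≤ C a ω then K (T a ω) (T a ω) *
          (relWeight (T a ω) (otherPairs T C a ω) ^ 2 - 1 / G.real (Set.Ici (T a ω)) ^ 2)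
          else 0 := by
      rw [Finset.mul_sum, Finset.sum_div, ← Finset.sum_sub_distrib, Finset.mul_sum]
      refine Finset.sum_congr rfl fun a _ => ?_
      unfold limitTerm
      split_ifs
      · field_simp
      · simp
    rw [hsum, enorm_mul, enorm_inv hnpos.ne']
    have : ‖((m + 1 : ℕ) : ℝ)‖ₑ = ((m + 1 : ℕ) : ENNReal) := by
      rw [Real.enorm_eq_ofReal hnpos.le, ENNReal.ofReal_natCast]
    rw [this]
    refine mul_le_mul_right ((enorm_sum_le _ _).trans (Finset.sum_le_sum fun a _ => ?_)) _
    split_ifs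
    · rw [Real.enorm_eq_ofReal_abs, abs_mul]
    · simp
  refine (lintegral_mono hpt).trans ?_
  have hmeas : ∀ a : Fin (m + 1), Measurable fun ω =>
      if T a ω ≤ C a ω then e (T a ω, otherPairs T C a ω) else 0 := fun a =>
    Measurable.ite (measurableSet_le (hTm _) (hCm _))
      (hem.comp ((hTm _).prodMk (measurable_otherPairs hTm hCm a))) measurable_const
  rw [lintegral_const_mul _ (Finset.measurable_sum _ fun a _ => hmeas a),
    lintegral_finsetSum _ fun a _ => hmeas a]
  have hun := fun a : Fin (m + 1) => lintegral_uncensored (P := P) (F := F) (G := G) hTm hCm hlaw a hem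
  unfold otherPairs
  simp_rw [hun]
  rw [Finset.sum_const, Finset.card_univ, Fintype.card_fin, nsmul_eq_mul, ← mul_assoc,
    ENNReal.inv_mul_cancel (by simp) (ENNReal.natCast_ne_top _), one_mul]

end Sample

end

/-! ### Part (i): truncation where few subjects are expected at risk. -/

noncomputable section

section Sample

variable {Ω : Type*} [MeasurableSpace Ω] {P : Measure Ω} {F G : Measure ℝ}
    {T C : ℕ → Ω → ℝ}

/-- The contribution of an uncensored observation at `x` to `√n |Dₙ|`, with `n = m + 1`, cut off
to `0` where the probability of being at risk at `x` is at most `c / n`. -/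
def cutTerm (F G : Measure ℝ) (k : ℝ → ℝ) (c : ℝ) {m : ℕ} (p : ℝ × (Fin m → ℝ × ℝ)) : ENNReal :=
  if c / (m + 1 : ℕ) < F.real (Set.Ici p.1) * G.real (Set.Ici p.1) then
    ENNReal.ofReal (√(m + 1 : ℕ) * (|k p.1| * (relWeight p.1 p.2 / (m + 1 : ℕ)) ^ 2)) else 0

theorem measurable_cutTerm {k : ℝ → ℝ} (hk : Measurable k) (c : ℝ) {m : ℕ} :
    Measurable (cutTerm F G k c (m := m)) := by
  have h1 : Measurable fun p : ℝ × (Fin m → ℝ × ℝ) => k p.1 := hk.comp measurable_fst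
  have h2 : Measurable fun p : ℝ × (Fin m → ℝ × ℝ) => G.real (Set.Ici p.1) :=
    (measurable_measureReal_Ici G).comp measurable_fst
  have h3 : Measurable fun p : ℝ × (Fin m → ℝ × ℝ) => F.real (Set.Ici p.1) :=
    (measurable_measureReal_Ici F).comp measurable_fst
  exact Measurable.ite (measurableSet_lt measurable_const (h3.mul h2))
    (((h1.abs.mul ((measurable_relWeight.div_const _).pow_const 2)).const_mul _).ennreal_ofReal)
    measurable_const

variable [IsProbabilityMeasure G]

/-- At an uncensored time the product is the upper tail of the law of `X` at `X` itself, and such a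
tail value is at most `u` with probability at most `u`. A union bound does the rest. -/
theorem measure_exists_uncensored_le [IsProbabilityMeasure P]
    (hTm : ∀ i, Measurable (T i)) (hCm : ∀ i, Measurable (C i))
    (hpair : ∀ i, P.map (fun ω => (T i ω, C i ω)) = F.prod G) (n : ℕ) (u : ENNReal) :
    P {ω | ∃ a : Fin n, T a ω ≤ C a ω ∧ F (Set.Ici (T a ω)) * G (Set.Ici (T a ω)) ≤ u} ≤
      n * u := by
  have hsub : {ω | ∃ a : Fin n, T a ω ≤ C a ω ∧ F (Set.Ici (T a ω)) * G (Set.Ici (T a ω)) ≤ u} ⊆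
      ⋃ a : Fin n, obsTime T C a ⁻¹' {x | P.map (obsTime T C a) (Set.Ici x) ≤ u} := by
    rintro ω ⟨a, h1, h2⟩
    refine Set.mem_iUnion.2 ⟨a, ?_⟩
    simp only [Set.mem_preimage, Set.mem_ofPred_eq]
    rw [measure_map_obsTime_Ici hTm hCm hpair, obsTime, min_eq_left h1]
    exact h2
  refine (measure_mono hsub).trans ((measure_iUnion_fintype_le _ _).trans ?_)
  calc _ ≤ ∑ _a : Fin n, u := by
        refine Finset.sum_le_sum fun a _ => ?_
        have hm : Measurable (obsTime T C a) := (hTm a).min (hCm a)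
        have := Measure.isProbabilityMeasure_map (μ := P) hm.aemeasurable
        exact (Measure.le_map_apply hm.aemeasurable _).trans
          (measure_setOf_measure_Ici_le (P.map (obsTime T C a)) u)
    _ = _ := by simp

variable [IsProbabilityMeasure F]

/-- The uniform bound `E W² ≤ 2/g²` gives `n · g · √n |k| / n² · 2/g² = 2|k| / (√n g)`. -/
theorem mul_lintegral_cutTerm_le {k : ℝ → ℝ} {c : ℝ} {x : ℝ} (hg : 0 < G.real (Set.Ici x))
    (m : ℕ) :
    ((m + 1 : ℕ) : ENNReal) * (G (Set.Ici x) * ∫⁻ z, cutTerm F G k c (x, z) ∂(pairLaw F G m)) ≤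
      if c / (m + 1 : ℕ) < F.real (Set.Ici x) * G.real (Set.Ici x) then
        ENNReal.ofReal (√(1 / (m + 1 : ℕ)) * (2 * |k x| / G.real (Set.Ici x))) else 0 := by
  unfold cutTerm
  simp only
  split_ifs with h
  · have hsq := integral_relWeight_sq_le (F := F) hg m
    have hfin : ∀ z : Fin m → ℝ × ℝ, √(m + 1 : ℕ) * (|k x| * (relWeight x z / (m + 1 : ℕ)) ^ 2) =
        √(m + 1 : ℕ) * |k x| / (m + 1 : ℕ) ^ 2 * relWeight x z ^ 2 := fun z => by
      rw [div_pow]; ring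
    have hn : (0 : ℝ) < (m + 1 : ℕ) := by positivity
    simp_rw [hfin]
    rw [← ofReal_integral_eq_lintegral_ofReal ((integrable_relWeight_sq F G m x).const_mul _)
      (ae_of_all _ fun z => by positivity), integral_const_mul, ← ofReal_measureReal_Ici,
      ← ENNReal.ofReal_natCast, ← ENNReal.ofReal_mul hg.le, ← ENNReal.ofReal_mul hn.le]
    refine ENNReal.ofReal_le_ofReal ?_
    set g := G.real (Set.Ici x)
    set n : ℝ := ((m + 1 : ℕ) : ℝ)
    have hs : 0 < √n := Real.sqrt_pos.2 hn
    calc n * (g * (√n * |k x| / n ^ 2 * ∫ z, relWeight x z ^ 2 ∂(pairLaw F G m)))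
        ≤ n * (g * (√n * |k x| / n ^ 2 * (2 / g ^ 2))) := by gcongr
      _ = √(1 / n) * (2 * |k x| / g) := by
          rw [Real.sqrt_div zero_le_one, Real.sqrt_one]
          have : n = √n ^ 2 := (Real.sq_sqrt hn.le).symm
          field_simp
          rw [← this]
  · simp

theorem tendsto_lintegral_cutTerm [IsProbabilityMeasure P] (hF : F (Set.Iic 0) = 0)
    (hTm : ∀ i, Measurable (T i)) (hCm : ∀ i, Measurable (C i))
    (hpair : ∀ i, P.map (fun ω => (T i ω, C i ω)) = F.prod G)
    {k : ℝ → ℝ} (hk : Measurable k)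
    (hint : IntegrableOn (fun x => |k x| * √(survLeft F x / survLeft G x))
      (obsInterval (P.map (obsTime T C 0))) F) {c : ℝ} (hc : 0 < c) :
    Tendsto (fun m : ℕ => ∫⁻ x, ((m + 1 : ℕ) : ENNReal) * (G (Set.Ici x) *
      ∫⁻ z, cutTerm F G k c (x, z) ∂(pairLaw F G m)) ∂F) atTop (𝓝 0) := by
  set I := obsInterval (P.map (obsTime T C 0)) with hI
  have h0 : ∫⁻ _ : ℝ, (0 : ENNReal) ∂F = 0 := by simp
  rw [← h0]
  refine tendsto_lintegral_of_dominated_convergence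
    (fun x => I.indicator (fun x => ENNReal.ofReal
      (2 / √c * (|k x| * √(survLeft F x / survLeft G x)))) x)
    (fun m => ?_) (fun m => ?_) ?_ ?_
  · exact ((measurable_measure_Ici G).mul
      (measurable_cutTerm hk c).lintegral_prod_right').const_mul _
  · filter_upwards [ae_mem_obsInterval_or hF hTm hCm hpair] with x hx
    rcases hx with hx | hx
    · obtain ⟨-, hs, hg⟩ := (mem_obsInterval_iff hTm hCm hpair x).1 hx
      rw [Set.indicator_of_mem (hI ▸ hx), survLeft_eq_measureReal_Ici, survLeft_eq_measureReal_Ici]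
      refine (mul_lintegral_cutTerm_le hg m).trans ?_
      split_ifs with h
      · refine ENNReal.ofReal_le_ofReal ?_
        set g := G.real (Set.Ici x)
        set s := F.real (Set.Ici x)
        have hn : (0 : ℝ) < (m + 1 : ℕ) := by positivity
        set n : ℝ := ((m + 1 : ℕ) : ℝ)
        -- The truncation is used here: it exchanges the decay in `n` for the factor `√(s g)`, which
        -- gives a majorant free of `n`.
        have h1 : 1 / n ≤ s * g / c := by
          rw [le_div_iff₀ hc, one_div_mul_eq_div]; exact h.le
        have h2 : √(s * g / c) = √(s / g) * g / √c := by
          rw [Real.sqrt_div (by positivity), show s * g = s / g * g ^ 2 by field_simp,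
            Real.sqrt_mul (by positivity), Real.sqrt_sq hg.le]
        calc √(1 / n) * (2 * |k x| / g) ≤ √(s * g / c) * (2 * |k x| / g) := by gcongr
          _ = _ := by rw [h2]; field_simp
      · exact zero_le
    · rw [hx.2, zero_mul, mul_zero]; exact zero_le
  · rw [lintegral_indicator (measurableSet_obsInterval _)]
    exact (hint.const_mul (2 / √c)).lintegral_lt_top.ne
  · filter_upwards [ae_mem_obsInterval_or hF hTm hCm hpair] with x hx
    rcases hx with hx | hx
    · obtain ⟨-, hs, hg⟩ := (mem_obsInterval_iff hTm hCm hpair x).1 hx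
      have hlim : Tendsto (fun m : ℕ => √(1 / ((m + 1 : ℕ) : ℝ))) atTop (𝓝 0) := by
        have := (Real.continuous_sqrt.tendsto 0).comp
          (tendsto_one_div_add_atTop_nhds_zero_nat (𝕜 := ℝ))
        rw [Real.sqrt_zero] at this
        refine this.congr fun m => ?_
        simp
      have hlim' := ENNReal.tendsto_ofReal (hlim.mul_const (2 * |k x| / G.real (Set.Ici x)))
      rw [zero_mul, ENNReal.ofReal_zero] at hlim'
      refine tendsto_of_tendsto_of_tendsto_of_le_of_le tendsto_const_nhds hlim'
        (fun _ => zero_le) fun m => (mul_lintegral_cutTerm_le hg m).trans ?_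
      split_ifs
      · exact le_rfl
      · exact zero_le
    · simp [hx.2]

theorem tendstoInMeasure_sqrt_mul_kmDiag [IsProbabilityMeasure P] (hF : F (Set.Iic 0) = 0)
    (hTm : ∀ i, Measurable (T i)) (hCm : ∀ i, Measurable (C i))
    (hlaw : ∀ n, P.map (fun ω (i : Fin n) => (T i ω, C i ω)) = pairLaw F G n)
    {K : ℝ → ℝ → ℝ} (hk : Measurable fun x => K x x)
    {σ : (n : ℕ) → Ω → Equiv.Perm (Fin n)}
    (hσ : ∀ n ω, IsKMOrder (fun i : Fin n => obsTime T C i ω)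
      (fun i : Fin n => censInd T C i ω) (σ n ω))
    (hint : IntegrableOn (fun x => |K x x| * √(survLeft F x / survLeft G x))
      (obsInterval (P.map (obsTime T C 0))) F) :
    TendstoInMeasure P
      (fun (n : ℕ) ω => √(n : ℝ) * kmDiag K (fun i : Fin n => obsTime T C i ω)
        (fun i : Fin n => censInd T C i ω) (σ n ω)) atTop (fun _ => 0) := by
  have hpair := map_pair_eq hTm hCm hlaw
  rw [tendstoInMeasure_iff_norm]
  intro ε hε
  rw [← tendsto_add_atTop_iff_nat 1, ENNReal.tendsto_nhds_zero]
  intro η hη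
  -- With `c < η/2`, the discarded event has probability at most `n · (c/n) = c`, for every `n`; `c`
  -- then stays fixed while `n → ∞`.
  obtain ⟨c, hc0, hcη⟩ := ENNReal.lt_iff_exists_nnreal_btwn.1 (ENNReal.half_pos hη.ne')
  have hc : (0 : ℝ) < c := by exact_mod_cast hc0
  have hε' : ENNReal.ofReal ε ≠ 0 := by simpa using hε
  have hJ := ENNReal.Tendsto.div_const (tendsto_lintegral_cutTerm hF hTm hCm hpair hk hint hc)
    (b := ENNReal.ofReal ε) (Or.inr hε')
  rw [ENNReal.zero_div] at hJ
  filter_upwards [ENNReal.tendsto_nhds_zero.1 hJ (η / 2) (ENNReal.half_pos hη.ne')] with m hm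
  have hn : (0 : ℝ) < (m + 1 : ℕ) := by positivity
  have hmeas : ∀ a : Fin (m + 1), Measurable fun ω => if T a ω ≤ C a ω then
      cutTerm F G (fun x => K x x) c (T a ω, otherPairs T C a ω) else 0 := fun a =>
    Measurable.ite (measurableSet_le (hTm _) (hCm _))
      ((measurable_cutTerm hk c).comp ((hTm _).prodMk (measurable_otherPairs hTm hCm a)))
      measurable_const
  have hsub : {ω | ε ≤ ‖√((m + 1 : ℕ) : ℝ) * kmDiag K
        (fun i : Fin (m + 1) => obsTime T C i ω)
        (fun i : Fin (m + 1) => censInd T C i ω) (σ (m + 1) ω) - 0‖} ⊆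
      {ω | ∃ a : Fin (m + 1), T a ω ≤ C a ω ∧
        F (Set.Ici (T a ω)) * G (Set.Ici (T a ω)) ≤ ENNReal.ofReal (c / (m + 1 : ℕ))} ∪
      {ω | ENNReal.ofReal ε ≤ ∑ a : Fin (m + 1), if T a ω ≤ C a ω then
        cutTerm F G (fun x => K x x) c (T a ω, otherPairs T C a ω) else 0} := by
    intro ω hω
    by_cases hex : ∃ a : Fin (m + 1), T a ω ≤ C a ω ∧
        F (Set.Ici (T a ω)) * G (Set.Ici (T a ω)) ≤ ENNReal.ofReal (c / (m + 1 : ℕ))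
    · exact Or.inl hex
    refine Or.inr ?_
    push Not at hex
    simp only [Set.mem_ofPred_eq, sub_zero] at hω ⊢
    refine (ENNReal.ofReal_le_ofReal hω).trans ?_
    rw [ofReal_norm, kmDiag_sample_eq K (hσ (m + 1) ω), Finset.mul_sum]
    refine (enorm_sum_le _ _).trans (Finset.sum_le_sum fun a _ => ?_)
    split_ifs with ha
    · have hlt := hex a ha
      have hlt' : (c : ℝ) / (m + 1 : ℕ) <
          F.real (Set.Ici (T a ω)) * G.real (Set.Ici (T a ω)) := by
        rw [← ofReal_measureReal_Ici, ← ofReal_measureReal_Ici,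
          ← ENNReal.ofReal_mul measureReal_nonneg] at hlt
        exact (ENNReal.ofReal_lt_ofReal_iff_of_nonneg (by positivity)).1 hlt
      simp only [cutTerm, hlt', if_true]
      rw [Real.enorm_eq_ofReal_abs, abs_mul, abs_mul, abs_of_nonneg (Real.sqrt_nonneg _),
        abs_of_nonneg (sq_nonneg (relWeight _ _ / _))]
    · simp
  refine (measure_mono hsub).trans ((measure_union_le _ _).trans ?_)
  rw [← ENNReal.add_halves η]
  refine add_le_add ?_ ?_
  · refine (measure_exists_uncensored_le hTm hCm hpair (m + 1) _).trans (le_trans (le_of_eq ?_)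
      hcη.le)
    rw [← ENNReal.ofReal_natCast, ← ENNReal.ofReal_mul hn.le, mul_div_cancel₀ _ hn.ne']
    exact ENNReal.ofReal_coe_nnreal
  · refine (meas_ge_le_lintegral_div (Finset.measurable_sum _ fun a _ => hmeas a).aemeasurable hε'
      ENNReal.ofReal_ne_top).trans (le_trans (le_of_eq ?_) hm)
    congr 1
    rw [lintegral_finsetSum _ fun a _ => hmeas a]
    have hun := fun a : Fin (m + 1) => lintegral_uncensored (P := P) (F := F) (G := G) hTm hCm hlaw a
      (measurable_cutTerm (F := F) (G := G) hk c)
    unfold otherPairs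
    simp_rw [hun]
    rw [Finset.sum_const, Finset.card_univ, Fintype.card_fin, nsmul_eq_mul]
    exact (lintegral_const_mul _ ((measurable_measure_Ici G).mul
      (measurable_cutTerm hk c).lintegral_prod_right')).symm

end Sample

end

theorem mainTheorem7 {Ω : Type*} [MeasurableSpace Ω] (P : Measure Ω) [IsProbabilityMeasure P]
    (F G : Measure ℝ) [IsProbabilityMeasure F] [IsProbabilityMeasure G]
    (hF : F (Set.Iic 0) = 0) (hG : G (Set.Iic 0) = 0)
    (T C : ℕ → Ω → ℝ)
    (hTm : ∀ i, Measurable (T i)) (hCm : ∀ i, Measurable (C i))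
    (hTlaw : ∀ i, P.map (T i) = F) (hClaw : ∀ i, P.map (C i) = G)
    (hTind : iIndepFun T P) (hCind : iIndepFun C P)
    (hTC : IndepFun (fun ω i => T i ω) (fun ω i => C i ω) P)
    (K : ℝ → ℝ → ℝ) (hK : Measurable (Function.uncurry K))
    (σ : (n : ℕ) → Ω → Equiv.Perm (Fin n))
    (hσ : ∀ n ω, IsKMOrder (fun i : Fin n => obsTime T C i ω)
      (fun i : Fin n => censInd T C i ω) (σ n ω)) :
    (IntegrableOn (fun x => |K x x| * √(survLeft F x / survLeft G x))
        (obsInterval (P.map (obsTime T C 0))) F →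
      TendstoInMeasure P
        (fun (n : ℕ) ω => √(n : ℝ) * kmDiag K (fun i : Fin n => obsTime T C i ω)
          (fun i : Fin n => censInd T C i ω) (σ n ω))
        atTop (fun _ => 0)) ∧
    (IntegrableOn (fun x => |K x x| / survLeft G x)
        (obsInterval (P.map (obsTime T C 0))) F →
      TendstoInMeasure P
        (fun (n : ℕ) ω => (n : ℝ) * kmDiag K (fun i : Fin n => obsTime T C i ω)
          (fun i : Fin n => censInd T C i ω) (σ n ω))
        atTop
        (fun _ => ∫ x in obsInterval (P.map (obsTime T C 0)), K x x / survLeft G x ∂F)) := by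
  have hlaw := map_pairs_eq_pairLaw hTm hCm hTlaw hClaw hTind hCind hTC
  have hk : Measurable fun x => K x x := hK.comp (measurable_id.prodMk measurable_id)
  exact ⟨tendstoInMeasure_sqrt_mul_kmDiag hF hTm hCm hlaw hk hσ,
    tendstoInMeasure_mul_kmDiag hF hTm hCm hlaw hk hσ⟩
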